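/- Let $\mathcal N\subset B(H)$ be a von Neumann algebra on a complex Hilbert space with a faithful normal semifinite trace $\tau$. Let $K(\mathcal N)$ be the norm-closed two-sided ideal of $\mathcal N$ generated by the projections of finite trace, and let $l^1(\mathcal N)=\{A\in\mathcal N:\tau(|A|)<\infty\}$ with the norm $\|A\|_1=\|A\|+\tau(|A|)$; $\tau$ also denotes the linear extension of the trace to $l^1(\mathcal N)$. Let $\mathrm{Gl}_K(\mathcal N)$ be the group of invertible elements of $\mathcal N$ of the form $1+K$ with $K\in K(\mathcal N)$, and $\mathcal U_K(\mathcal N)=\mathcal U(\mathcal N)\cap \mathrm{Gl}_K(\mathcal N)$, both with the operator norm topology. Let $\pi_1(\mathcal U_K(\mathcal N))$ be the group of free homotopy classes $[s]$ of continuous loops $s:S^1=\mathbb R/\mathbb Z\to\mathcal U_K(\mathcal N)$ under pointwise multiplication. Call a continuous loop $\sigma:S^1\to\mathrm{Gl}_K(\mathcal N)$ a $C^1$ loop if $\sigma-1$, as a function on $[0,1]$, is continuously differentiable with values in $l^1(\mathcal N)$ (one-sided derivatives at the end points), and put $$w(\sigma)=\frac1{2\pi i}\int_0^1\tau\big(\sigma(x)^{-1}\sigma'(x)\big)\,dx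 .$$ **Proposition 3.2.** (i) For every $C^1$ loop $\sigma$ the integrand is continuous on $[0,1]$ and $w(\sigma)\in\mathbb R$. (ii) Every continuous loop in $\mathcal U_K(\mathcal N)$ is freely homotopic in $\mathrm{Gl}_K(\mathcal N)$ to a $C^1$ loop $\sigma$; one can choose $\sigma$ with $\sigma-1\in C^1(S^1,l^1(\mathcal N))$, i.e. such that $\sigma'(0)=\sigma'(1)$ too. (iii) The winding number extends to $\pi_1(\mathcal U_K(\mathcal N))$: there is a unique group homomorphism $W:\pi_1(\mathcal U_K(\mathcal N))\to\mathbb R$ such that $W([s])=w(\sigma)$ for every continuous loop $s$ in $\mathcal U_K(\mathcal N)$ and every $C^1$ loop $\sigma$ that is freely homotopic to $s$ in $\mathrm{Gl}_K(\mathcal N)$. -/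

import Mathlib

open scoped ENNReal NNReal Topology ComplexStarModule

noncomputable section

namespace WindingNumber

variable {H : Type*} [NormedAddCommGroup H] [InnerProductSpace ℂ H] [CompleteSpace H]

/-- A faithful normal semifinite trace on a von Neumann algebra `N ⊆ B(H)`: a weight on the
cone of positive elements of `N` with values in `[0, ∞]`. Only the values of `toFun` on positive
elements of `N` are meaningful, and all laws concern these. -/
structure FNSTrace (N : VonNeumannAlgebra H) where
  /-- The value of the trace on a positive element of `N`. -/
  toFun : (H →L[ℂ] H) → ℝ≥0∞
  map_add : ∀ A ∈ N, ∀ B ∈ N, 0 ≤ A → 0 ≤ B → toFun (A + B) = toFun A + toFun B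
  map_smul : ∀ (c : ℝ≥0), ∀ A ∈ N, 0 ≤ A → toFun ((c : ℝ) • A) = c * toFun A
  tracial : ∀ A ∈ N, toFun (star A * A) = toFun (A * star A)
  faithful : ∀ A ∈ N, 0 ≤ A → toFun A = 0 → A = 0
  normal : ∀ (S : Set (H →L[ℂ] H)) (A : H →L[ℂ] H), S.Nonempty → DirectedOn (· ≤ ·) S →
    (∀ B ∈ S, B ∈ N ∧ 0 ≤ B) → A ∈ N → IsLUB S A → toFun A = ⨆ B ∈ S, toFun B
  semifinite : ∀ A ∈ N, 0 ≤ A → A ≠ 0 → ∃ B ∈ N, 0 ≤ B ∧ B ≤ A ∧ B ≠ 0 ∧ toFun B < ∞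

variable {N : VonNeumannAlgebra H} (τ : FNSTrace N)

/-- The two-sided ideal of `N` generated by the projections of finite trace: the linear span of
the products `A P B` with `A, B ∈ N` and `P ∈ N` a projection with `τ(P) < ∞`. -/
def finiteIdeal : Submodule ℂ (H →L[ℂ] H) :=
  Submodule.span ℂ {T | ∃ A ∈ N, ∃ B ∈ N, ∃ P ∈ N,
    IsStarProjection P ∧ τ.toFun P < ∞ ∧ T = A * P * B}

/-- `K(N)`: the norm-closed two-sided ideal generated by the projections of finite trace. -/
def compactIdeal : Submodule ℂ (H →L[ℂ] H) := (finiteIdeal τ).topologicalClosure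

/-- `l¹(N)`: the operators `A ∈ N` with `τ(|A|) < ∞`. -/
def l1 : Set (H →L[ℂ] H) := {A | A ∈ N ∧ τ.toFun (CFC.abs A) < ∞}

/-- The norm `‖A‖₁ = ‖A‖ + τ(|A|)` of `l¹(N)`, as an extended nonnegative number. -/
def l1Norm (A : H →L[ℂ] H) : ℝ≥0∞ := ‖A‖ₑ + τ.toFun (CFC.abs A)

/-- The linear extension of the trace to `l¹(N)`, by decomposing an operator into its real and
imaginary parts and these into their positive and negative parts. -/
def trace (A : H →L[ℂ] H) : ℂ :=
  (((τ.toFun (ℜ A : H →L[ℂ] H)⁺).toReal - (τ.toFun (ℜ A : H →L[ℂ] H)⁻).toReal : ℝ) : ℂ) +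
  Complex.I *
    (((τ.toFun (ℑ A : H →L[ℂ] H)⁺).toReal - (τ.toFun (ℑ A : H →L[ℂ] H)⁻).toReal : ℝ) : ℂ)

/-- `f` is a `C¹` map on `S ⊆ ℝ` with values in the normed space `(l¹(N), ‖·‖₁)`: it has a
derivative (one-sided at boundary points of `S`) that is again continuous in `l¹(N)`. -/
def IsC1On (f : ℝ → H →L[ℂ] H) (S : Set ℝ) : Prop :=
  ∃ d : ℝ → H →L[ℂ] H,
    (∀ x ∈ S, f x ∈ l1 τ ∧ d x ∈ l1 τ) ∧
    (∀ x ∈ S, Filter.Tendsto (fun y => l1Norm τ ((y - x)⁻¹ • (f y - f x) - d x))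
      (𝓝[S \ {x}] x) (𝓝 0)) ∧
    (∀ x ∈ S, Filter.Tendsto (fun y => l1Norm τ (d y - d x)) (𝓝[S] x) (𝓝 0))

theorem compactIdeal_mul_left {A T : H →L[ℂ] H} (hA : A ∈ N) (hT : T ∈ compactIdeal τ) :
    A * T ∈ compactIdeal τ := by
  refine map_mem_closure (f := fun T : H →L[ℂ] H => A * T) (by fun_prop) hT ?_
  intro x hx
  induction hx using Submodule.span_induction with
  | mem x hx =>
    obtain ⟨B, hB, C, hC, P, hP, h1, h2, rfl⟩ := hx
    exact Submodule.subset_span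
      ⟨A * B, mul_mem hA hB, C, hC, P, hP, h1, h2, by simp only [mul_assoc]⟩
  | zero => simp
  | add x y _ _ hx hy => simpa [mul_add] using (finiteIdeal τ).add_mem hx hy
  | smul c x _ hx => simpa using (finiteIdeal τ).smul_mem c hx

/-- `Gl_K(N)`: the elements `1 + K`, `K ∈ K(N)`, that are invertible in `N`, with the topology
of the operator norm. -/
def GlK : Set (H →L[ℂ] H) :=
  {g | g ∈ N ∧ (∃ h ∈ N, g * h = 1 ∧ h * g = 1) ∧ g - 1 ∈ compactIdeal τ}

/-- `U_K(N) = U(N) ∩ Gl_K(N)`, as a subgroup of the unitary group of `B(H)`. -/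
def UK : Subgroup (unitary (H →L[ℂ] H)) where
  carrier := {u | (u : H →L[ℂ] H) ∈ N ∧ (u : H →L[ℂ] H) - 1 ∈ compactIdeal τ}
  one_mem' := ⟨one_mem N, by simp⟩
  mul_mem' := by
    rintro u v ⟨hu, hu'⟩ ⟨hv, hv'⟩
    refine ⟨mul_mem hu hv, ?_⟩
    have h := (compactIdeal τ).add_mem (compactIdeal_mul_left τ hu hv') hu'
    simpa [mul_sub] using h
  inv_mem' := by
    rintro u ⟨hu, hu'⟩
    have hs : ((u⁻¹ : unitary (H →L[ℂ] H)) : H →L[ℂ] H) ∈ N := star_mem hu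
    refine ⟨hs, ?_⟩
    have h := (compactIdeal τ).neg_mem (compactIdeal_mul_left τ hs hu')
    have e : ((u⁻¹ : unitary (H →L[ℂ] H)) : H →L[ℂ] H) * (u : H →L[ℂ] H) = 1 :=
      Unitary.coe_star_mul_self u
    rw [mul_sub, e, mul_one, neg_sub] at h
    exact h

theorem mem_GlK_of_mem_UK (u : UK τ) : ((u : unitary (H →L[ℂ] H)) : H →L[ℂ] H) ∈ GlK τ :=
  ⟨u.2.1, ⟨star ((u : unitary (H →L[ℂ] H)) : H →L[ℂ] H), star_mem u.2.1,
    Unitary.coe_mul_star_self _, Unitary.coe_star_mul_self _⟩, u.2.2⟩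

/-- The inclusion `U_K(N) ⊆ Gl_K(N)`. -/
def inclUK : C(UK τ, GlK τ) where
  toFun u := ⟨((u : unitary (H →L[ℂ] H)) : H →L[ℂ] H), mem_GlK_of_mem_UK τ u⟩
  continuous_toFun :=
    (continuous_subtype_val.comp continuous_subtype_val).subtype_mk _

instance : IsTopologicalGroup (UK τ) := Subgroup.instIsTopologicalGroupSubtypeMem (UK τ)

/-- Loops in `U_K(N)` form a group under pointwise multiplication. -/
instance : Group C(AddCircle (1 : ℝ), UK τ) := ContinuousMap.instGroupOfIsTopologicalGroup

/-- Free homotopy of loops in `U_K(N)`, as a congruence for pointwise multiplication. -/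
def freeHomotopyCon : Con C(AddCircle (1 : ℝ), UK τ) where
  r := ContinuousMap.Homotopic
  iseqv := ContinuousMap.Homotopic.equivalence
  mul' := by
    rintro a b c d ⟨F⟩ ⟨G⟩
    exact ⟨{ toContinuousMap := F.toContinuousMap * G.toContinuousMap
             map_zero_left := fun x => by simp
             map_one_left := fun x => by simp }⟩

/-- `π₁(U_K(N))`: the group of free homotopy classes of loops in `U_K(N)`, under pointwise
multiplication of loops. -/
def FreePi1 : Type _ := (freeHomotopyCon τ).Quotient

instance : Group (FreePi1 τ) := (freeHomotopyCon τ).group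

/-- The free homotopy class of a loop in `U_K(N)`. -/
def freeClass : C(AddCircle (1 : ℝ), UK τ) →* FreePi1 τ := (freeHomotopyCon τ).mk'

/-- A loop in `Gl_K(N)`, read as a function of period `1` on the real line. -/
def lift (s : C(AddCircle (1 : ℝ), GlK τ)) (x : ℝ) : H →L[ℂ] H := (s (x : AddCircle (1 : ℝ)) : _)

/-- The function `x ↦ τ(s(x)⁻¹ s'(x))` on `[0, 1]`, with one-sided derivatives at `0` and `1`. -/
def integrand (s : C(AddCircle (1 : ℝ), GlK τ)) (x : ℝ) : ℂ :=
  trace τ (Ring.inverse (lift τ s x) * derivWithin (lift τ s) (Set.Icc 0 1) x)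

/-- The winding number `w(s) = (2πi)⁻¹ ∫₀¹ τ(s(x)⁻¹ s'(x)) dx`. -/
def winding (s : C(AddCircle (1 : ℝ), GlK τ)) : ℂ :=
  (2 * Real.pi * Complex.I)⁻¹ * ∫ x in (0 : ℝ)..1, integrand τ s x

/-- A loop `s` in `Gl_K(N)` such that `s - 1` is `C¹` on `[0, 1]` with values in `l¹(N)`. -/
def IsC1Loop (s : C(AddCircle (1 : ℝ), GlK τ)) : Prop :=
  IsC1On τ (fun x => lift τ s x - 1) (Set.Icc 0 1)

/-- A loop `s` in `Gl_K(N)` such that `s - 1` is `C¹` on the circle with values in `l¹(N)`, so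
that the derivatives at the two end points of `[0, 1]` agree too. -/
def IsPeriodicC1Loop (s : C(AddCircle (1 : ℝ), GlK τ)) : Prop :=
  IsC1On τ (fun x => lift τ s x - 1) Set.univ

end WindingNumber

end

open ContinuousLinearMap

noncomputable section
namespace WindingNumber
variable {H : Type*} [NormedAddCommGroup H] [InnerProductSpace ℂ H] [CompleteSpace H]
variable {N : VonNeumannAlgebra H}

/-! The winding number is additive on products and vanishes on every `C¹` loop `σ` with `‖σ - 1‖ ≤ q
< 1`; everything else follows from these two facts and a density argument.

Additivity is the product rule together with cyclicity of the trace (`Loop.winding_mul`). For the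
vanishing (`Loop.winding_eq_zero`) put `b = 1 - σ`. By cyclicity `τ(b ^ m σ')` is, up to a constant
factor, the derivative of `τ(b ^ (m + 1))`, so it integrates to zero around the loop. Since `σ⁻¹ b ^
m = b ^ m + σ⁻¹ b ^ (m + 1)`, the integral of `τ(σ⁻¹ b ^ m σ')` does not depend on `m`; it is `O(q ^
m)`, hence zero.

Applied to `s⁻¹ σ`, this shows that uniformly close `C¹` loops have the same winding number. Every
loop is a uniform limit of `C¹` loops `1 + f`, with `f` a trigonometric polynomial whose
coefficients lie in the ideal generated by the finite projections
(`Loop.exists_isPeriodicC1Loop_mem`). So the winding number extends to a locally constant function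
on the space of loops, and a homotopy is a path in that space. It is real because `σ* σ` is
positive, hence homotopic to `1`, while the winding number of `σ*` is minus the conjugate of that of
`σ`.

The analytic input is that `l¹(N)` is a normed `N`-bimodule with a continuous, linear, cyclic trace.
It comes from the factorisation of trace class operators as `star y * z` with `y`, `z`
Hilbert–Schmidt. -/

/-! ### Double commutant, functional calculus and polar factorisation inside `N`. -/

theorem mem_of_commute_commutant {A : H →L[ℂ] H}
    (h : ∀ T ∈ N.commutant, Commute T A) : A ∈ N := by
  rw [← VonNeumannAlgebra.commutant_commutant N, VonNeumannAlgebra.mem_commutant_iff]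
  exact h

theorem commute_of_mem_commutant {A T : H →L[ℂ] H} (hA : A ∈ N) (hT : T ∈ N.commutant) :
    Commute T A :=
  (VonNeumannAlgebra.mem_commutant_iff.1 hT A hA).symm

theorem complex_smul_mem {A : H →L[ℂ] H} (c : ℂ) (hA : A ∈ N) : c • A ∈ N :=
  N.toStarSubalgebra.smul_mem hA c

theorem real_smul_mem {A : H →L[ℂ] H} (c : ℝ) (hA : A ∈ N) : c • A ∈ N := by
  have := complex_smul_mem (c : ℂ) hA
  rwa [Complex.coe_smul] at this

theorem mem_of_inverse {g h : H →L[ℂ] H} (hg : g ∈ N) (h1 : g * h = 1) (h2 : h * g = 1) :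
    h ∈ N := by
  refine mem_of_commute_commutant fun T hT => ?_
  have e := (commute_of_mem_commutant hg hT).eq
  calc T * h = h * g * (T * h) := by rw [h2, one_mul]
    _ = h * (T * g) * h := by rw [e]; simp only [mul_assoc]
    _ = h * T * (g * h) := by simp only [mul_assoc]
    _ = h * T := by rw [h1, mul_one]

theorem sqrt_mem {A : H →L[ℂ] H} (hA : A ∈ N) : CFC.sqrt A ∈ N := by
  refine mem_of_commute_commutant fun T hT => ?_
  exact ((commute_of_mem_commutant hA hT).symm.cfcₙ_nnreal _).symm

theorem abs_mem {A : H →L[ℂ] H} (hA : A ∈ N) : CFC.abs A ∈ N :=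
  sqrt_mem (mul_mem (star_mem hA) hA)

theorem posPart_mem {A : H →L[ℂ] H} (hA : A ∈ N) : A⁺ ∈ N := by
  refine mem_of_commute_commutant fun T hT => ?_
  rw [CFC.posPart_def]
  exact ((commute_of_mem_commutant hA hT).symm.cfcₙ_real _).symm

theorem negPart_mem {A : H →L[ℂ] H} (hA : A ∈ N) : A⁻ ∈ N := by
  rw [← CFC.posPart_neg]
  exact posPart_mem (neg_mem hA)

theorem norm_abs_apply (A : H →L[ℂ] H) (x : H) : ‖CFC.abs A x‖ = ‖A x‖ := by
  have h : ∀ B : H →L[ℂ] H, ((‖B x‖ : ℂ)) ^ 2 = inner ℂ x ((star B * B) x) := fun B => by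
    rw [star_eq_adjoint, mul_def, comp_apply, adjoint_inner_right, inner_self_eq_norm_sq_to_K]; rfl
  have h1 := h (CFC.abs A)
  rw [(CFC.abs_nonneg A).isSelfAdjoint.star_eq, CFC.abs_mul_abs, ← h A] at h1
  exact (sq_eq_sq₀ (norm_nonneg _) (norm_nonneg _)).1 (by exact_mod_cast h1)

/-- Douglas factorisation inside a von Neumann algebra. -/
theorem exists_contraction_factor {A B : H →L[ℂ] H} (hA : A ∈ N) (hB : B ∈ N)
    (h : ∀ x, ‖A x‖ ≤ ‖B x‖) : ∃ C ∈ N, ‖C‖ ≤ 1 ∧ A = C * B := by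
  set S : Submodule ℂ H := (LinearMap.range (B : H →ₗ[ℂ] H)).topologicalClosure with hS
  have hBS : ∀ x, B x ∈ S := fun x => Submodule.le_topologicalClosure _ ⟨x, rfl⟩
  have : CompleteSpace S := (Submodule.isClosed_topologicalClosure _).completeSpace_coe
  let e : H →ₗ[ℂ] S := (B : H →ₗ[ℂ] H).codRestrict S hBS
  have hd : DenseRange e := by
    intro y
    rw [closure_subtype]
    refine closure_mono ?_ y.2
    rintro _ ⟨x, rfl⟩
    exact ⟨e x, ⟨x, rfl⟩, rfl⟩
  have hn : ∀ x, ‖(A : H →ₗ[ℂ] H) x‖ ≤ 1 * ‖e x‖ := fun x => by simpa [e] using h x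
  -- `C` sends `B x` to `A x`, is extended by density to the closure of the range of `B`, and is
  -- zero on the orthogonal complement.
  let C₀ : S →L[ℂ] H := (A : H →ₗ[ℂ] H).extendOfNorm e
  have hC₀ : ∀ x, C₀ (e x) = A x := fun x => LinearMap.extendOfNorm_eq hd ⟨1, hn⟩ x
  let C : H →L[ℂ] H := C₀ ∘L S.orthogonalProjectionOnto
  have hC : ∀ x, C (B x) = A x := fun x => by
    have : S.orthogonalProjectionOnto (B x) = e x :=
      Submodule.orthogonalProjectionOnto_mem_subspace_eq_self (e x)
    simp only [C, comp_apply, this, hC₀]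
  have hperp : ∀ y ∈ Sᗮ, C y = 0 := fun y hy => by
    simp only [C, comp_apply,
      Submodule.orthogonalProjectionOnto_apply_of_mem_orthogonal hy, map_zero]
  refine ⟨C, mem_of_commute_commutant fun T hT => ?_, ?_, ?_⟩
  · have hTA := commute_of_mem_commutant hA hT
    have hTB := commute_of_mem_commutant hB hT
    have hTB' := commute_of_mem_commutant hB (star_mem hT)
    have hTx : ∀ x, T (B x) = B (T x) := fun x => congr($hTB x)
    have hTx' : ∀ x, star T (B x) = B (star T x) := fun x => congr($hTB' x)
    have hTAx : ∀ x, T (A x) = A (T x) := fun x => congr($hTA x)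
    have hon : ∀ y ∈ S, T (C y) = C (T y) := by
      intro y hy
      refine closure_minimal (s := (LinearMap.range (B : H →ₗ[ℂ] H) : Set H))
        (t := {y | T (C y) = C (T y)}) ?_ (isClosed_eq (by fun_prop) (by fun_prop)) hy
      rintro _ ⟨x, rfl⟩
      change T (C (B x)) = C (T (B x))
      rw [hC, hTx, hC, hTAx]
    -- The commutant is closed under adjoints, so `star T` also preserves the range of `B`.
    have hTperp : ∀ y ∈ Sᗮ, T y ∈ Sᗮ := by
      intro y hy
      rw [hS, Submodule.orthogonal_closure] at hy ⊢
      rw [Submodule.mem_orthogonal] at hy ⊢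
      rintro _ ⟨x, rfl⟩
      have := hy (star T (B x)) ⟨star T x, (hTx' x).symm⟩
      rwa [star_eq_adjoint, adjoint_inner_left] at this
    ext x
    obtain ⟨y, hy, z, hz, rfl⟩ := S.exists_add_mem_mem_orthogonal x
    simp only [mul_def, comp_apply, map_add, hon y hy, hperp z hz, hperp _ (hTperp z hz), map_zero]
  · refine (opNorm_comp_le _ _).trans ?_
    have h1 : ‖C₀‖ ≤ 1 := LinearMap.opNorm_extendOfNorm_le hd zero_le_one hn
    have h2 := S.orthogonalProjectionOnto_norm_le
    nlinarith [norm_nonneg C₀, norm_nonneg S.orthogonalProjectionOnto]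
  · ext x; exact (hC x).symm

/-- Since `A x` and `|A| x` have equal norms, Douglas factorisation works in both directions.
Contractions are enough below; no partial isometry is needed. -/
theorem exists_polar {A : H →L[ℂ] H} (hA : A ∈ N) :
    ∃ U ∈ N, ‖U‖ ≤ 1 ∧ A = U * CFC.abs A :=
  exists_contraction_factor hA (abs_mem hA) fun x => (norm_abs_apply A x).ge

theorem exists_abs_eq_mul {A : H →L[ℂ] H} (hA : A ∈ N) :
    ∃ V ∈ N, ‖V‖ ≤ 1 ∧ CFC.abs A = V * A :=
  exists_contraction_factor (abs_mem hA) hA fun x => (norm_abs_apply A x).le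
-- Hilbert–Schmidt operators and the ideal property of `l¹(N)`.
variable {τ : FNSTrace N}

theorem FNSTrace.map_zero (τ : FNSTrace N) : τ.toFun 0 = 0 := by
  simpa using τ.map_smul 0 0 (zero_mem N) le_rfl

theorem FNSTrace.mono (τ : FNSTrace N) {a b : H →L[ℂ] H} (ha : a ∈ N) (hb : b ∈ N) (h0 : 0 ≤ a)
    (h : a ≤ b) : τ.toFun a ≤ τ.toFun b := by
  have := τ.map_add a ha (b - a) (sub_mem hb ha) h0 (sub_nonneg.2 h)
  rw [add_sub_cancel] at this
  rw [this]
  exact le_self_add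

theorem FNSTrace.map_real_smul (τ : FNSTrace N) {a : H →L[ℂ] H} (ha : a ∈ N) (h0 : 0 ≤ a) {c : ℝ}
    (hc : 0 ≤ c) : τ.toFun (c • a) = ENNReal.ofReal c * τ.toFun a := by
  have := τ.map_smul ⟨c, hc⟩ a ha h0
  rw [ENNReal.ofReal_eq_coe_nnreal hc]
  exact this

variable (τ) in
/-- The positive operators of finite trace. -/
structure IsFinPos (a : H →L[ℂ] H) : Prop where
  mem : a ∈ N
  nonneg : 0 ≤ a
  lt_top : τ.toFun a < ∞

variable (τ) in
/-- The Hilbert–Schmidt operators of the trace. -/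
structure IsHS (x : H →L[ℂ] H) : Prop where
  mem : x ∈ N
  lt_top : τ.toFun (star x * x) < ∞

theorem IsFinPos.add {a b : H →L[ℂ] H} (ha : IsFinPos τ a) (hb : IsFinPos τ b) :
    IsFinPos τ (a + b) :=
  ⟨add_mem ha.mem hb.mem, add_nonneg ha.nonneg hb.nonneg, by
    rw [τ.map_add a ha.mem b hb.mem ha.nonneg hb.nonneg]
    exact ENNReal.add_lt_top.2 ⟨ha.lt_top, hb.lt_top⟩⟩

theorem IsFinPos.smul {a : H →L[ℂ] H} (ha : IsFinPos τ a) {c : ℝ} (hc : 0 ≤ c) :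
    IsFinPos τ (c • a) :=
  ⟨real_smul_mem c ha.mem, smul_nonneg hc ha.nonneg, by
    rw [τ.map_real_smul ha.mem ha.nonneg hc]
    exact ENNReal.mul_lt_top ENNReal.ofReal_lt_top ha.lt_top⟩

theorem IsFinPos.of_le {a b : H →L[ℂ] H} (hb : IsFinPos τ b) (ha : a ∈ N) (h0 : 0 ≤ a)
    (h : a ≤ b) : IsFinPos τ a :=
  ⟨ha, h0, (τ.mono ha hb.mem h0 h).trans_lt hb.lt_top⟩

theorem IsHS.isFinPos {x : H →L[ℂ] H} (hx : IsHS τ x) : IsFinPos τ (star x * x) :=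
  ⟨mul_mem (star_mem hx.mem) hx.mem, star_mul_self_nonneg x, hx.lt_top⟩

theorem IsHS.adjoint {x : H →L[ℂ] H} (hx : IsHS τ x) : IsHS τ (star x) :=
  ⟨star_mem hx.mem, by rw [star_star, ← τ.tracial x hx.mem]; exact hx.lt_top⟩

theorem IsHS.add {x y : H →L[ℂ] H} (hx : IsHS τ x) (hy : IsHS τ y) : IsHS τ (x + y) := by
  have hm := add_mem hx.mem hy.mem
  refine ⟨hm, (((hx.isFinPos.add hy.isFinPos).smul (zero_le_two (α := ℝ))).of_le
    (mul_mem (star_mem hm) hm) (star_mul_self_nonneg _) ?_).lt_top⟩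
  rw [← sub_nonneg]
  convert star_mul_self_nonneg (x - y) using 1
  simp only [star_add, star_sub, two_smul]
  noncomm_ring

theorem star_mul_mul_le (a x : H →L[ℂ] H) :
    star (a * x) * (a * x) ≤ (‖a‖ ^ 2) • (star x * x) := by
  have := star_left_conjugate_le_conjugate
    (CStarAlgebra.star_mul_le_algebraMap_norm_sq (a := a)) x
  rw [Algebra.algebraMap_eq_smul_one, mul_smul_comm, mul_one, smul_mul_assoc] at this
  simpa [mul_assoc] using this

theorem IsHS.mul_left {a x : H →L[ℂ] H} (ha : a ∈ N) (hx : IsHS τ x) : IsHS τ (a * x) := by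
  have hm := mul_mem ha hx.mem
  exact ⟨hm, ((hx.isFinPos.smul (sq_nonneg ‖a‖)).of_le (mul_mem (star_mem hm) hm)
    (star_mul_self_nonneg _) (star_mul_mul_le a x)).lt_top⟩

theorem IsHS.mul_right {a x : H →L[ℂ] H} (hx : IsHS τ x) (ha : a ∈ N) : IsHS τ (x * a) := by
  have := (hx.adjoint.mul_left (star_mem ha)).adjoint
  simpa using this

theorem IsHS.smul {x : H →L[ℂ] H} (hx : IsHS τ x) (c : ℂ) : IsHS τ (c • x) := by
  have := hx.mul_left (complex_smul_mem c (one_mem N))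
  simpa using this

theorem star_mul_add_star_mul_le (y z : H →L[ℂ] H) :
    star y * z + star z * y ≤ star y * y + star z * z := by
  rw [← sub_nonneg]
  convert star_mul_self_nonneg (y - z) using 1
  simp only [star_sub]
  noncomm_ring

theorem isFinPos_abs {A : H →L[ℂ] H} (hA : A ∈ l1 τ) : IsFinPos τ (CFC.abs A) :=
  ⟨abs_mem hA.1, CFC.abs_nonneg A, hA.2⟩

/-- With `h = |A|^(1/2)` and `A = U h h`, the factors of `X A` are `X U h` and `h`. Traciality
replaces `(X U h)(X U h)*` by `(X U h)*(X U h)`, which is at most `h * h` because `X U` is a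
contraction. -/
theorem exists_mul_eq_star_mul {X A : H →L[ℂ] H} (hX : X ∈ N) (hX1 : ‖X‖ ≤ 1) (hA : A ∈ l1 τ) :
    ∃ y z, IsHS τ y ∧ IsHS τ z ∧ X * A = star y * z ∧
      τ.toFun (star y * y) ≤ τ.toFun (CFC.abs A) ∧ τ.toFun (star z * z) = τ.toFun (CFC.abs A) := by
  obtain ⟨U, hU, hU1, e⟩ := exists_polar hA.1
  set h := CFC.sqrt (CFC.abs A) with hh
  have hs : star h = h := (CFC.sqrt_nonneg _).isSelfAdjoint.star_eq
  have hm : h ∈ N := sqrt_mem (abs_mem hA.1)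
  have h2 : h * h = CFC.abs A := CFC.sqrt_mul_sqrt_self _ (CFC.abs_nonneg A)
  have hHS : IsHS τ h := ⟨hm, by rw [hs, h2]; exact hA.2⟩
  have hXU := mul_mem hX hU
  have hy : IsHS τ (X * U * h) := hHS.mul_left hXU
  refine ⟨star (X * U * h), h, hy.adjoint, hHS, ?_, ?_, by rw [hs, h2]⟩
  · rw [star_star, mul_assoc, h2, mul_assoc, ← e]
  · rw [star_star, ← τ.tracial _ hy.mem]
    refine τ.mono hy.isFinPos.mem (abs_mem hA.1) hy.isFinPos.nonneg ?_
    refine (star_mul_mul_le _ _).trans ?_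
    rw [hs, h2]
    have hn : ‖X * U‖ ^ 2 ≤ 1 := by
      refine pow_le_one₀ (norm_nonneg _) ((norm_mul_le _ _).trans ?_)
      exact mul_le_one₀ hX1 (norm_nonneg _) hU1
    simpa using smul_le_smul_of_nonneg_right hn (CFC.abs_nonneg A)

theorem exists_eq_star_mul {A : H →L[ℂ] H} (hA : A ∈ l1 τ) :
    ∃ y z, IsHS τ y ∧ IsHS τ z ∧ A = star y * z := by
  obtain ⟨y, z, hy, hz, e, -⟩ :=
    exists_mul_eq_star_mul (one_mem N) ContinuousLinearMap.norm_id_le hA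
  exact ⟨y, z, hy, hz, by rw [← e, one_mul]⟩

theorem mem_l1_of_abs_le {A b : H →L[ℂ] H} (hA : A ∈ N) (hb : IsFinPos τ b)
    (h : CFC.abs A + CFC.abs A ≤ b) : A ∈ l1 τ := by
  refine ⟨hA, (hb.of_le (abs_mem hA) (CFC.abs_nonneg A) (le_trans ?_ h)).lt_top⟩
  exact le_add_of_nonneg_left (CFC.abs_nonneg A)

/-- Absorbing `V` from `|star y * z| = V (star y * z)` into `y` writes the absolute value as a
product of the same kind. Being self-adjoint, it also equals the adjoint product, and the sum of the
two is dominated by a sum of squares. -/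
theorem star_mul_mem_l1 {y z : H →L[ℂ] H} (hy : IsHS τ y) (hz : IsHS τ z) :
    star y * z ∈ l1 τ := by
  have hm := mul_mem (star_mem hy.mem) hz.mem
  obtain ⟨V, hV, -, e⟩ := exists_abs_eq_mul hm
  have hy' := hy.mul_right (star_mem hV)
  refine mem_l1_of_abs_le hm (hy'.isFinPos.add hz.isFinPos) ?_
  refine le_trans (le_of_eq ?_) (star_mul_add_star_mul_le _ _)
  have h1 : CFC.abs (star y * z) = star (y * star V) * z := by rw [e]; simp [mul_assoc]
  have h2 : CFC.abs (star y * z) = star z * (y * star V) := by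
    have := congr(star $h1)
    rwa [(CFC.abs_nonneg _).isSelfAdjoint.star_eq, star_mul, star_star] at this
  rw [← h1, ← h2]

theorem mul_left_mem_l1 {X A : H →L[ℂ] H} (hX : X ∈ N) (hA : A ∈ l1 τ) : X * A ∈ l1 τ := by
  obtain ⟨y, z, hy, hz, rfl⟩ := exists_eq_star_mul hA
  have := star_mul_mem_l1 (hy.mul_right (star_mem hX)) hz
  simpa [mul_assoc] using this

theorem mul_right_mem_l1 {X A : H →L[ℂ] H} (hA : A ∈ l1 τ) (hX : X ∈ N) : A * X ∈ l1 τ := by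
  obtain ⟨y, z, hy, hz, rfl⟩ := exists_eq_star_mul hA
  have := star_mul_mem_l1 hy (hz.mul_right hX)
  simpa [mul_assoc] using this

theorem star_mem_l1 {A : H →L[ℂ] H} (hA : A ∈ l1 τ) : star A ∈ l1 τ := by
  obtain ⟨y, z, hy, hz, rfl⟩ := exists_eq_star_mul hA
  simpa using star_mul_mem_l1 hz hy

theorem smul_mem_l1 {A : H →L[ℂ] H} (c : ℂ) (hA : A ∈ l1 τ) : c • A ∈ l1 τ := by
  simpa using mul_left_mem_l1 (complex_smul_mem c (one_mem N)) hA

theorem zero_mem_l1 : (0 : H →L[ℂ] H) ∈ l1 τ := ⟨zero_mem N, by simp [τ.map_zero]⟩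

/-- The operator inequality `|A + B| ≤ |A| + |B|` is false in general. Instead `|A + B| = V A + V B`
is split into Hilbert–Schmidt products and added to its own adjoint, as for a single product. -/
theorem add_mem_l1 {A B : H →L[ℂ] H} (hA : A ∈ l1 τ) (hB : B ∈ l1 τ) : A + B ∈ l1 τ := by
  have hm := add_mem hA.1 hB.1
  obtain ⟨V, hV, -, e⟩ := exists_abs_eq_mul hm
  obtain ⟨y, z, hy, hz, eA⟩ := exists_eq_star_mul (mul_left_mem_l1 hV hA)
  obtain ⟨y', z', hy', hz', eB⟩ := exists_eq_star_mul (mul_left_mem_l1 hV hB)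
  refine mem_l1_of_abs_le hm
    ((hy.isFinPos.add hz.isFinPos).add (hy'.isFinPos.add hz'.isFinPos)) ?_
  refine le_trans (le_of_eq ?_)
    (add_le_add (star_mul_add_star_mul_le y z) (star_mul_add_star_mul_le y' z'))
  have h1 : CFC.abs (A + B) = star y * z + star y' * z' := by rw [e, mul_add, eA, eB]
  have h2 : CFC.abs (A + B) = star z * y + star z' * y' := by
    have := congr(star $h1)
    rw [(CFC.abs_nonneg (A + B)).isSelfAdjoint.star_eq] at this
    simpa using this
  nth_rw 1 [h1, h2]
  abel

theorem IsFinPos.mem_l1 {a : H →L[ℂ] H} (ha : IsFinPos τ a) : a ∈ l1 τ :=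
  ⟨ha.mem, by rw [CFC.abs_of_nonneg a ha.nonneg]; exact ha.lt_top⟩

variable (τ) in
/-- `l¹(N)` as a linear subspace. -/
def l1Submodule : Submodule ℂ (H →L[ℂ] H) where
  carrier := l1 τ
  add_mem' := add_mem_l1
  zero_mem' := zero_mem_l1
  smul_mem' c _ hA := smul_mem_l1 c hA

theorem finiteIdeal_le_l1Submodule : finiteIdeal τ ≤ l1Submodule τ := by
  refine Submodule.span_le.2 ?_
  rintro _ ⟨A, hA, B, hB, P, hP, h1, h2, rfl⟩
  refine mul_right_mem_l1 (mul_left_mem_l1 hA (IsFinPos.mem_l1 ⟨hP, h1.nonneg, h2⟩)) hB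

/-! ### Linearity, cyclicity and continuity of the trace. -/

variable (τ) in
/-- The trace of a self-adjoint operator, as the difference of the traces of its positive and
negative parts. -/
def realTrace (A : H →L[ℂ] H) : ℝ := (τ.toFun A⁺).toReal - (τ.toFun A⁻).toReal

theorem trace_eq (A : H →L[ℂ] H) :
    trace τ A = (realTrace τ (ℜ A : H →L[ℂ] H) : ℂ) +
      Complex.I * (realTrace τ (ℑ A : H →L[ℂ] H) : ℂ) := rfl

theorem realTrace_neg (A : H →L[ℂ] H) : realTrace τ (-A) = -realTrace τ A := by
  simp [realTrace]

theorem IsFinPos.realTrace_eq_toReal {a : H →L[ℂ] H} (ha : IsFinPos τ a) :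
    realTrace τ a = (τ.toFun a).toReal := by
  have h1 : a⁺ = a := (CFC.posPart_eq_self a).2 ha.nonneg
  have h2 : a⁻ = 0 := (CFC.negPart_eq_zero_iff a ha.nonneg.isSelfAdjoint).2 ha.nonneg
  rw [realTrace, h1, h2, τ.map_zero]; simp

theorem isFinPos_posPart {A : H →L[ℂ] H} (hA : A ∈ l1 τ) (hs : IsSelfAdjoint A) :
    IsFinPos τ A⁺ := by
  refine (isFinPos_abs hA).of_le (posPart_mem hA.1) (CFC.posPart_nonneg A) ?_
  rw [← CFC.posPart_add_negPart A hs]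
  exact le_add_of_nonneg_right (CFC.negPart_nonneg A)

theorem isFinPos_negPart {A : H →L[ℂ] H} (hA : A ∈ l1 τ) (hs : IsSelfAdjoint A) :
    IsFinPos τ A⁻ := by
  refine (isFinPos_abs hA).of_le (negPart_mem hA.1) (CFC.negPart_nonneg A) ?_
  rw [← CFC.posPart_add_negPart A hs]
  exact le_add_of_nonneg_left (CFC.posPart_nonneg A)

theorem IsFinPos.toReal_add {a b : H →L[ℂ] H} (ha : IsFinPos τ a) (hb : IsFinPos τ b) :
    (τ.toFun (a + b)).toReal = (τ.toFun a).toReal + (τ.toFun b).toReal := by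
  rw [τ.map_add a ha.mem b hb.mem ha.nonneg hb.nonneg,
    ENNReal.toReal_add ha.lt_top.ne hb.lt_top.ne]

theorem realTrace_add {A B : H →L[ℂ] H} (hA : A ∈ l1 τ) (hB : B ∈ l1 τ) (hAs : IsSelfAdjoint A)
    (hBs : IsSelfAdjoint B) : realTrace τ (A + B) = realTrace τ A + realTrace τ B := by
  have hAB := add_mem_l1 hA hB
  have hABs := hAs.add hBs
  have a1 := isFinPos_posPart hA hAs
  have a2 := isFinPos_negPart hA hAs
  have b1 := isFinPos_posPart hB hBs
  have b2 := isFinPos_negPart hB hBs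
  have c1 := isFinPos_posPart hAB hABs
  have c2 := isFinPos_negPart hAB hABs
  -- Without differences, both sides are sums of positive operators, on which the trace is additive
  -- by assumption.
  have e : (A + B)⁺ + (A⁻ + B⁻) = (A⁺ + B⁺) + (A + B)⁻ := by
    have h1 := CFC.posPart_sub_negPart A hAs
    have h2 := CFC.posPart_sub_negPart B hBs
    have h3 := CFC.posPart_sub_negPart (A + B) hABs
    rw [sub_eq_iff_eq_add] at h1 h2 h3
    rw [h3, h1, h2]
    abel
  have := congr((τ.toFun $e).toReal)
  rw [c1.toReal_add (a2.add b2), (a1.add b1).toReal_add c2, a2.toReal_add b2,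
    a1.toReal_add b1] at this
  simp only [realTrace]
  linarith

theorem realTrace_smul {A : H →L[ℂ] H} (hA : A ∈ l1 τ) (hAs : IsSelfAdjoint A) (c : ℝ) :
    realTrace τ (c • A) = c * realTrace τ A := by
  have a1 := isFinPos_posPart hA hAs
  have a2 := isFinPos_negPart hA hAs
  have key : ∀ c : ℝ, 0 ≤ c → realTrace τ (c • A) = c * realTrace τ A := fun c hc => by
    rw [realTrace, CFC.posPart_smul_of_nonneg hc, CFC.negPart_smul_of_nonneg hc,
      τ.map_real_smul a1.mem a1.nonneg hc, τ.map_real_smul a2.mem a2.nonneg hc,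
      ENNReal.toReal_mul, ENNReal.toReal_mul, ENNReal.toReal_ofReal hc, realTrace]
    ring
  rcases le_total 0 c with hc | hc
  · exact key c hc
  · have := key (-c) (neg_nonneg.2 hc)
    rw [neg_smul, realTrace_neg] at this
    linarith

theorem re_mem_l1 {A : H →L[ℂ] H} (hA : A ∈ l1 τ) : (ℜ A : H →L[ℂ] H) ∈ l1 τ := by
  rw [realPart_apply_coe, ← Complex.coe_smul]
  exact smul_mem_l1 _ (add_mem_l1 hA (star_mem_l1 hA))

theorem im_mem_l1 {A : H →L[ℂ] H} (hA : A ∈ l1 τ) : (ℑ A : H →L[ℂ] H) ∈ l1 τ := by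
  have := re_mem_l1 (smul_mem_l1 (-Complex.I) hA)
  simpa [realPart_I_smul] using this

theorem trace_add {A B : H →L[ℂ] H} (hA : A ∈ l1 τ) (hB : B ∈ l1 τ) :
    trace τ (A + B) = trace τ A + trace τ B := by
  simp only [trace_eq, map_add, AddMemClass.coe_add]
  rw [realTrace_add (re_mem_l1 hA) (re_mem_l1 hB) (ℜ A).2 (ℜ B).2,
    realTrace_add (im_mem_l1 hA) (im_mem_l1 hB) (ℑ A).2 (ℑ B).2]
  push_cast
  ring

theorem trace_real_smul {A : H →L[ℂ] H} (hA : A ∈ l1 τ) (c : ℝ) :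
    trace τ (c • A) = c * trace τ A := by
  simp only [trace_eq, map_smul, selfAdjoint.val_smul]
  rw [realTrace_smul (re_mem_l1 hA) (ℜ A).2, realTrace_smul (im_mem_l1 hA) (ℑ A).2]
  push_cast
  ring

theorem trace_I_smul (A : H →L[ℂ] H) : trace τ (Complex.I • A) = Complex.I * trace τ A := by
  simp only [trace_eq, realPart_I_smul, imaginaryPart_I_smul, 
    NegMemClass.coe_neg, realTrace_neg]
  push_cast
  linear_combination (-(realTrace τ (ℑ A : H →L[ℂ] H) : ℂ)) * Complex.I_mul_I

theorem trace_smul {A : H →L[ℂ] H} (hA : A ∈ l1 τ) (c : ℂ) :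
    trace τ (c • A) = c * trace τ A := by
  have e : c • A = c.re • A + Complex.I • (c.im • A) := by
    nth_rw 1 [← Complex.re_add_im c]
    rw [add_smul, mul_comm, mul_smul, Complex.coe_smul, Complex.coe_smul]
  have h : ∀ r : ℝ, r • A ∈ l1 τ := fun r => by
    rw [← Complex.coe_smul]; exact smul_mem_l1 _ hA
  rw [e, trace_add (h _) (smul_mem_l1 _ (h _)), trace_I_smul, trace_real_smul hA,
    trace_real_smul hA]
  nth_rw 3 [← Complex.re_add_im c]
  ring

theorem trace_star (A : H →L[ℂ] H) : trace τ (star A) = star (trace τ A) := by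
  have h1 : ℜ (star A) = ℜ A := by ext1; simp [realPart_apply_coe, add_comm]
  have h2 : ℑ (star A) = -ℑ A := by
    ext1; simp [imaginaryPart_apply_coe, ← smul_neg]
  simp only [trace_eq, h1, h2, NegMemClass.coe_neg, realTrace_neg]
  simp

theorem IsFinPos.trace_eq_toReal {a : H →L[ℂ] H} (ha : IsFinPos τ a) :
    trace τ a = (τ.toFun a).toReal := by
  have hs := ha.nonneg.isSelfAdjoint
  have h1 : (ℜ a : H →L[ℂ] H) = a := hs.coe_realPart
  have h2 : ℑ a = 0 := hs.imaginaryPart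
  rw [trace_eq, h1, h2, ha.realTrace_eq_toReal]
  simp [realTrace, τ.map_zero]

theorem trace_sub {A B : H →L[ℂ] H} (hA : A ∈ l1 τ) (hB : B ∈ l1 τ) :
    trace τ (A - B) = trace τ A - trace τ B := by
  rw [sub_eq_add_neg, ← neg_one_smul ℂ B, trace_add hA (smul_mem_l1 _ hB), trace_smul hB]
  ring

theorem IsHS.trace_star_mul_self {x : H →L[ℂ] H} (hx : IsHS τ x) :
    trace τ (star x * x) = trace τ (x * star x) := by
  have := hx.adjoint.isFinPos
  rw [star_star] at this
  rw [hx.isFinPos.trace_eq_toReal, this.trace_eq_toReal, τ.tracial x hx.mem]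

/-- Polarisation of `τ(x* x) = τ(x x*)` at `x = z + c y` with `c = ±1, ±i`. -/
theorem IsHS.trace_star_mul_comm {y z : H →L[ℂ] H} (hy : IsHS τ y) (hz : IsHS τ z) :
    trace τ (star y * z) = trace τ (z * star y) := by
  have e1 := fun c : ℂ => (hz.add (hy.smul c)).trace_star_mul_self
  have hl : ∀ x w : H →L[ℂ] H, IsHS τ x → IsHS τ w → star x * w ∈ l1 τ := fun x w hx hw =>
    star_mul_mem_l1 hx hw
  have hr : ∀ x w : H →L[ℂ] H, IsHS τ x → IsHS τ w → x * star w ∈ l1 τ := fun x w hx hw => by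
    simpa using star_mul_mem_l1 hx.adjoint hw.adjoint
  have expand : ∀ c : ℂ,
      trace τ (star (z + c • y) * (z + c • y)) = trace τ (star z * z) + c * trace τ (star z * y)
        + star c * trace τ (star y * z) + star c * c * trace τ (star y * y) := fun c => by
    rw [← trace_smul (hl _ _ hz hy), ← trace_smul (hl _ _ hy hz), ← trace_smul (hl _ _ hy hy),
      ← trace_add (hl _ _ hz hz) (smul_mem_l1 _ (hl _ _ hz hy)),
      ← trace_add (add_mem_l1 (hl _ _ hz hz) (smul_mem_l1 _ (hl _ _ hz hy)))
        (smul_mem_l1 _ (hl _ _ hy hz)),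
      ← trace_add (add_mem_l1 (add_mem_l1 (hl _ _ hz hz) (smul_mem_l1 _ (hl _ _ hz hy)))
        (smul_mem_l1 _ (hl _ _ hy hz))) (smul_mem_l1 _ (hl _ _ hy hy))]
    congr 1
    simp only [star_add, star_smul, add_mul, mul_add, smul_mul_assoc, mul_smul_comm,
      smul_add, smul_smul]
    rw [mul_comm (star c) c]
    abel
  have expand' : ∀ c : ℂ,
      trace τ ((z + c • y) * star (z + c • y)) = trace τ (z * star z) + c * trace τ (y * star z)
        + star c * trace τ (z * star y) + star c * c * trace τ (y * star y) := fun c => by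
    rw [← trace_smul (hr _ _ hy hz), ← trace_smul (hr _ _ hz hy), ← trace_smul (hr _ _ hy hy),
      ← trace_add (hr _ _ hz hz) (smul_mem_l1 _ (hr _ _ hy hz)),
      ← trace_add (add_mem_l1 (hr _ _ hz hz) (smul_mem_l1 _ (hr _ _ hy hz)))
        (smul_mem_l1 _ (hr _ _ hz hy)),
      ← trace_add (add_mem_l1 (add_mem_l1 (hr _ _ hz hz) (smul_mem_l1 _ (hr _ _ hy hz)))
        (smul_mem_l1 _ (hr _ _ hz hy))) (smul_mem_l1 _ (hr _ _ hy hy))]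
    congr 1
    simp only [star_add, star_smul, add_mul, mul_add, smul_mul_assoc, mul_smul_comm,
      smul_add, smul_smul]
    rw [mul_comm (star c) c]
    abel
  simp only [expand, expand'] at e1
  have f0 := e1 1
  have f1 := e1 Complex.I
  have f0' := e1 (-1)
  have f1' := e1 (-Complex.I)
  simp only [star_one, star_neg, Complex.star_def, Complex.conj_I] at f0 f1 f0' f1'
  have hI := Complex.I_mul_I
  generalize Complex.I = i at *
  linear_combination (1/4) * (f0 - f0' + i * f1 - i * f1') +
    (-(1/2)) * (trace τ (star z * y) - trace τ (star y * z) - trace τ (y * star z) +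
      trace τ (z * star y)) * hI

theorem trace_mul_comm {A X : H →L[ℂ] H} (hA : A ∈ l1 τ) (hX : X ∈ N) :
    trace τ (X * A) = trace τ (A * X) := by
  obtain ⟨y, z, hy, hz, rfl⟩ := exists_eq_star_mul hA
  have h1 : X * (star y * z) = star (y * star X) * z := by simp [mul_assoc]
  have h2 := (hy.mul_right (star_mem hX)).trace_star_mul_comm hz
  have h3 := hy.trace_star_mul_comm (hz.mul_right hX)
  rw [h1, h2, mul_assoc, h3]
  simp [mul_assoc]

/-- This is positivity of `τ((y - z)* (y - z))`, expanded. -/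
theorem IsHS.two_mul_re_trace_le {y z : H →L[ℂ] H} (hy : IsHS τ y) (hz : IsHS τ z) :
    2 * (trace τ (star y * z)).re ≤
      (τ.toFun (star y * y)).toReal + (τ.toFun (star z * z)).toReal := by
  have hyz : IsHS τ (y + (-1 : ℂ) • z) := hy.add (hz.smul _)
  have e : star (y + (-1 : ℂ) • z) * (y + (-1 : ℂ) • z) =
      (star y * y + star z * z) - (star y * z + star (star y * z)) := by
    simp only [star_add, star_mul, star_star, neg_smul, one_smul, star_neg]
    noncomm_ring
  have l := star_mul_mem_l1 hy hz
  have h := congr((trace τ $e).re)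
  rw [hyz.isFinPos.trace_eq_toReal, trace_sub (hy.isFinPos.add hz.isFinPos).mem_l1
      (add_mem_l1 l (star_mem_l1 l)), trace_add l (star_mem_l1 l), trace_star,
    (hy.isFinPos.add hz.isFinPos).trace_eq_toReal, hy.isFinPos.toReal_add hz.isFinPos] at h
  have h0 := ENNReal.toReal_nonneg (a := τ.toFun (star (y + (-1 : ℂ) • z) * (y + (-1 : ℂ) • z)))
  simp only [Complex.ofReal_re, Complex.sub_re, Complex.add_re, Complex.star_def,
    Complex.conj_re] at h
  linarith

theorem re_trace_mul_le {X A : H →L[ℂ] H} (hX : X ∈ N) (hX1 : ‖X‖ ≤ 1) (hA : A ∈ l1 τ) :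
    (trace τ (X * A)).re ≤ (τ.toFun (CFC.abs A)).toReal := by
  obtain ⟨y, z, hy, hz, e, h1, h2⟩ := exists_mul_eq_star_mul hX hX1 hA
  have := hy.two_mul_re_trace_le hz
  rw [e]
  have h3 := ENNReal.toReal_mono hA.2.ne h1
  rw [h2] at this
  linarith

theorem norm_trace_mul_le_of_contraction {X A : H →L[ℂ] H} (hX : X ∈ N) (hX1 : ‖X‖ ≤ 1)
    (hA : A ∈ l1 τ) : ‖trace τ (X * A)‖ ≤ (τ.toFun (CFC.abs A)).toReal := by
  -- A unimodular `c` rotates the trace onto the positive axis, where the bound on the real part is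
  -- a bound on the norm.
  obtain ⟨c, hc, e⟩ := RCLike.exists_norm_eq_mul_self (trace τ (X * A))
  have := re_trace_mul_le (X := c • X) (complex_smul_mem c hX)
    (by rw [norm_smul, hc, one_mul]; exact hX1) hA
  rw [smul_mul_assoc, trace_smul (mul_left_mem_l1 hX hA), ← e] at this
  simpa using this

theorem norm_trace_mul_le {X A : H →L[ℂ] H} (hX : X ∈ N) (hA : A ∈ l1 τ) :
    ‖trace τ (X * A)‖ ≤ ‖X‖ * (τ.toFun (CFC.abs A)).toReal := by
  rcases eq_or_ne X 0 with rfl | h0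
  · rw [zero_mul, ← zero_smul ℂ (0 : H →L[ℂ] H), trace_smul zero_mem_l1]; simp
  have hn : ‖X‖ ≠ 0 := norm_ne_zero_iff.2 h0
  have hc : ‖((‖X‖ : ℂ)⁻¹)‖ = ‖X‖⁻¹ := by simp
  have := norm_trace_mul_le_of_contraction (X := (‖X‖ : ℂ)⁻¹ • X) (complex_smul_mem _ hX)
    (by rw [norm_smul, hc, inv_mul_cancel₀ hn]) hA
  rw [smul_mul_assoc, trace_smul (mul_left_mem_l1 hX hA), norm_mul, hc,
    inv_mul_le_iff₀ (by positivity)] at this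
  exact this

/-! ### The trace norm and the normed space `L1`. -/

variable (τ) in
/-- The trace norm `τ(|A|)`. -/
def traceNorm (A : H →L[ℂ] H) : ℝ := (τ.toFun (CFC.abs A)).toReal

theorem traceNorm_nonneg (A : H →L[ℂ] H) : 0 ≤ traceNorm τ A := ENNReal.toReal_nonneg

/-- The trace norm is attained as `τ(V A)` at a contraction `V`, so the norm inequalities that
follow reduce to bounds on the trace. -/
theorem exists_traceNorm_eq {A : H →L[ℂ] H} (hA : A ∈ l1 τ) :
    ∃ V ∈ N, ‖V‖ ≤ 1 ∧ (traceNorm τ A : ℂ) = trace τ (V * A) := by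
  obtain ⟨V, hV, hV1, e⟩ := exists_abs_eq_mul hA.1
  exact ⟨V, hV, hV1, by rw [← e, (isFinPos_abs hA).trace_eq_toReal]; rfl⟩

theorem traceNorm_add_le {A B : H →L[ℂ] H} (hA : A ∈ l1 τ) (hB : B ∈ l1 τ) :
    traceNorm τ (A + B) ≤ traceNorm τ A + traceNorm τ B := by
  obtain ⟨V, hV, hV1, e⟩ := exists_traceNorm_eq (add_mem_l1 hA hB)
  rw [mul_add, trace_add (mul_left_mem_l1 hV hA) (mul_left_mem_l1 hV hB)] at e
  have := congr(($e).re)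
  simp only [Complex.ofReal_re, Complex.add_re] at this
  rw [this]
  exact add_le_add (re_trace_mul_le hV hV1 hA) (re_trace_mul_le hV hV1 hB)

theorem norm_eq_traceNorm {A : H →L[ℂ] H} {z : ℂ} (h : (traceNorm τ A : ℂ) = z) :
    traceNorm τ A = ‖z‖ := by
  rw [← h, Complex.norm_real, Real.norm_of_nonneg (traceNorm_nonneg A)]

theorem traceNorm_mul_left_le {X A : H →L[ℂ] H} (hX : X ∈ N) (hA : A ∈ l1 τ) :
    traceNorm τ (X * A) ≤ ‖X‖ * traceNorm τ A := by
  obtain ⟨V, hV, hV1, e⟩ := exists_traceNorm_eq (mul_left_mem_l1 hX hA)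
  rw [norm_eq_traceNorm e, ← mul_assoc]
  refine (norm_trace_mul_le (mul_mem hV hX) hA).trans ?_
  refine mul_le_mul_of_nonneg_right ((norm_mul_le _ _).trans ?_) (traceNorm_nonneg A)
  exact mul_le_of_le_one_left (norm_nonneg _) hV1

theorem traceNorm_mul_right_le {X A : H →L[ℂ] H} (hX : X ∈ N) (hA : A ∈ l1 τ) :
    traceNorm τ (A * X) ≤ ‖X‖ * traceNorm τ A := by
  obtain ⟨V, hV, hV1, e⟩ := exists_traceNorm_eq (mul_right_mem_l1 hA hX)
  rw [norm_eq_traceNorm e, ← mul_assoc, ← trace_mul_comm (mul_left_mem_l1 hV hA) hX, ← mul_assoc]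
  refine (norm_trace_mul_le (mul_mem hX hV) hA).trans ?_
  refine mul_le_mul_of_nonneg_right ((norm_mul_le _ _).trans ?_) (traceNorm_nonneg A)
  exact mul_le_of_le_one_right (norm_nonneg _) hV1

theorem traceNorm_star_le {A : H →L[ℂ] H} (hA : A ∈ l1 τ) :
    traceNorm τ (star A) ≤ traceNorm τ A := by
  obtain ⟨V, hV, hV1, e⟩ := exists_traceNorm_eq (star_mem_l1 hA)
  have e1 : V * star A = star (A * star V) := by simp
  rw [norm_eq_traceNorm e, e1, trace_star, norm_star, ← trace_mul_comm hA (star_mem hV)]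
  exact norm_trace_mul_le_of_contraction (star_mem hV) (by rwa [norm_star]) hA

variable (τ) in
/-- The normed space `(l¹(N), ‖·‖₁)`. -/
def L1 : Type _ := l1Submodule τ

namespace L1

/-- Only the algebraic structure is taken from the submodule: its operator norm must not compete
with `‖·‖₁`. -/
instance : AddCommGroup (L1 τ) := inferInstanceAs (AddCommGroup (l1Submodule τ))
instance : Module ℂ (L1 τ) := inferInstanceAs (Module ℂ (l1Submodule τ))

/-- The inclusion of `l¹(N)` in `B(H)`. -/
def valLinear : L1 τ →ₗ[ℂ] (H →L[ℂ] H) := (l1Submodule τ).subtype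

theorem valLinear_mem (A : L1 τ) : valLinear A ∈ l1 τ := Subtype.property A

theorem valLinear_injective : Function.Injective (valLinear (τ := τ)) := Subtype.val_injective

/-- An element of `l¹(N)`, as a point of the normed space. -/
def mk (A : H →L[ℂ] H) (hA : A ∈ l1 τ) : L1 τ := (⟨A, hA⟩ : l1Submodule τ)

variable (τ) in
/-- The norm `‖A‖₁ = ‖A‖ + τ(|A|)`. -/
def addGroupNorm : AddGroupNorm (L1 τ) where
  toFun A := ‖valLinear A‖ + traceNorm τ (valLinear A)
  map_zero' := by simp [traceNorm, τ.map_zero]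
  add_le' A B := by
    have h1 := norm_add_le (valLinear A) (valLinear B)
    have h2 := traceNorm_add_le (valLinear_mem A) (valLinear_mem B)
    rw [map_add]
    linarith
  neg' A := by simp [traceNorm]
  eq_zero_of_map_eq_zero' A h := by
    refine valLinear_injective ?_
    rw [_root_.map_zero, ← norm_eq_zero]
    have h1 := norm_nonneg (valLinear A)
    have h2 := traceNorm_nonneg (τ := τ) (valLinear A)
    linarith

instance : NormedAddCommGroup (L1 τ) := (addGroupNorm τ).toNormedAddCommGroup

theorem norm_def (A : L1 τ) : ‖A‖ = ‖valLinear A‖ + traceNorm τ (valLinear A) := rfl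

theorem norm_le_of_le {A B : L1 τ} {c : ℝ} (h1 : ‖valLinear A‖ ≤ c * ‖valLinear B‖)
    (h2 : traceNorm τ (valLinear A) ≤ c * traceNorm τ (valLinear B)) : ‖A‖ ≤ c * ‖B‖ := by
  rw [norm_def, norm_def]; linarith

instance : NormedSpace ℂ (L1 τ) where
  norm_smul_le c A := by
    refine norm_le_of_le ?_ ?_
    · rw [map_smul, norm_smul]
    · have h := traceNorm_mul_left_le (complex_smul_mem c (one_mem N)) (valLinear_mem A)
      rw [smul_mul_assoc, one_mul] at h
      rw [map_smul]
      refine h.trans (mul_le_mul_of_nonneg_right ?_ (traceNorm_nonneg _))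
      rw [norm_smul]
      exact mul_le_of_le_one_right (norm_nonneg _) ContinuousLinearMap.norm_id_le

/-- The inclusion of `l¹(N)` in `B(H)` as a continuous map. -/
def val : L1 τ →L[ℂ] (H →L[ℂ] H) :=
  valLinear.mkContinuous 1 fun A => by
    rw [one_mul, norm_def]
    exact le_add_of_nonneg_right (traceNorm_nonneg _)

theorem val_injective : Function.Injective (val (τ := τ)) := valLinear_injective

theorem val_real_smul (c : ℝ) (A : L1 τ) : val (c • A) = c • val A :=
  val.map_smul_of_tower c A

theorem val_mem (A : L1 τ) : val A ∈ l1 τ := A.valLinear_mem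

@[simp] theorem val_mk (A : H →L[ℂ] H) (hA : A ∈ l1 τ) : val (mk A hA) = A := rfl

theorem norm_le {A B : L1 τ} {c : ℝ} (h1 : ‖val A‖ ≤ c * ‖val B‖)
    (h2 : traceNorm τ (val A) ≤ c * traceNorm τ (val B)) : ‖A‖ ≤ c * ‖B‖ := norm_le_of_le h1 h2

theorem l1Norm_val (A : L1 τ) : l1Norm τ (val A) = ‖A‖ₑ := by
  rw [← ofReal_norm, norm_def, ENNReal.ofReal_add (norm_nonneg _) (traceNorm_nonneg _),
    ofReal_norm, traceNorm, ENNReal.ofReal_toReal A.valLinear_mem.2.ne]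
  rfl

/-- The trace as a continuous linear functional. -/
def tr : L1 τ →L[ℂ] ℂ :=
  LinearMap.mkContinuous
    { toFun := fun A => trace τ (val A)
      map_add' := fun A B => by rw [map_add, trace_add A.val_mem B.val_mem]
      map_smul' := fun c A => by rw [map_smul, trace_smul A.val_mem]; rfl } 1 fun A => by
    have := norm_trace_mul_le_of_contraction (one_mem N) ContinuousLinearMap.norm_id_le A.val_mem
    rw [one_mul] at this
    rw [one_mul, norm_def]
    exact this.trans (le_add_of_nonneg_left (norm_nonneg _))

theorem tr_apply (A : L1 τ) : tr A = trace τ (val A) := rfl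

/-- Left multiplication by an element of `N`. -/
def lmul (X : N) (A : L1 τ) : L1 τ := mk (X * val A) (mul_left_mem_l1 X.2 A.val_mem)

/-- Right multiplication by an element of `N`. -/
def rmul (A : L1 τ) (X : N) : L1 τ := mk (val A * X) (mul_right_mem_l1 A.val_mem X.2)

/-- The adjoint. -/
def adj (A : L1 τ) : L1 τ := mk (star (val A)) (star_mem_l1 A.val_mem)

@[simp] theorem val_lmul (X : N) (A : L1 τ) : val (lmul X A) = X * val A := rfl
@[simp] theorem val_rmul (X : N) (A : L1 τ) : val (rmul A X) = val A * X := rfl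
@[simp] theorem val_adj (A : L1 τ) : val (adj A) = star (val A) := rfl

theorem tr_lmul_eq_tr_rmul (X : N) (A : L1 τ) : tr (lmul X A) = tr (rmul A X) :=
  trace_mul_comm A.val_mem X.2

theorem tr_adj (A : L1 τ) : tr (adj A) = star (tr A) := trace_star _

theorem norm_lmul_le (X : N) (A : L1 τ) : ‖lmul X A‖ ≤ ‖X‖ * ‖A‖ :=
  norm_le (norm_mul_le _ _) (traceNorm_mul_left_le X.2 A.val_mem)

theorem norm_rmul_le (A : L1 τ) (X : N) : ‖rmul A X‖ ≤ ‖X‖ * ‖A‖ :=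
  norm_le (by rw [mul_comm]; exact norm_mul_le _ _) (traceNorm_mul_right_le X.2 A.val_mem)

theorem norm_adj_le (A : L1 τ) : ‖adj A‖ ≤ 1 * ‖A‖ :=
  norm_le (by rw [one_mul, val_adj, norm_star])
    (by rw [one_mul]; exact traceNorm_star_le A.val_mem)

end L1

theorem continuous_of_biadditive {E F G : Type*} [SeminormedAddCommGroup E]
    [SeminormedAddCommGroup F] [SeminormedAddCommGroup G] (f : E → F → G)
    (h1 : ∀ x x' y, f (x - x') y = f x y - f x' y) (h2 : ∀ x y y', f x (y - y') = f x y - f x y')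
    (hf : ∀ x y, ‖f x y‖ ≤ ‖x‖ * ‖y‖) : Continuous fun p : E × F => f p.1 p.2 := by
  rw [continuous_iff_continuousAt]
  rintro ⟨x₀, y₀⟩
  rw [ContinuousAt, tendsto_iff_norm_sub_tendsto_zero]
  have hc : Filter.Tendsto (fun p : E × F => ‖p.1 - x₀‖ * ‖p.2‖ + ‖x₀‖ * ‖p.2 - y₀‖) (𝓝 (x₀, y₀))
      (𝓝 0) := Continuous.tendsto' (by fun_prop) _ _ (by simp)
  refine squeeze_zero (fun _ => norm_nonneg _) (fun p => ?_) hc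
  have e : f p.1 p.2 - f x₀ y₀ = f (p.1 - x₀) p.2 + f x₀ (p.2 - y₀) := by rw [h1, h2]; abel
  rw [e]
  exact (norm_add_le _ _).trans (add_le_add (hf _ _) (hf _ _))

namespace L1

theorem continuous_lmul : Continuous fun p : N × L1 τ => lmul p.1 p.2 :=
  continuous_of_biadditive lmul
    (fun x x' y => val_injective (by simp [sub_mul]))
    (fun x y y' => val_injective (by simp [mul_sub])) norm_lmul_le

theorem continuous_rmul : Continuous fun p : L1 τ × N => rmul p.1 p.2 :=
  continuous_of_biadditive rmul
    (fun x x' y => val_injective (by simp [sub_mul]))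
    (fun x y y' => val_injective (by simp [mul_sub]))
    (fun A X => by rw [mul_comm]; exact norm_rmul_le A X)

theorem adj_sub (A B : L1 τ) : adj (A - B) = adj A - adj B := val_injective (by simp)

theorem continuous_adj : Continuous (adj : L1 τ → L1 τ) := by
  refine (LipschitzWith.of_dist_le_mul (K := 1) fun A B => ?_).continuous
  rw [dist_eq_norm, dist_eq_norm, ← adj_sub]
  exact norm_adj_le _

end L1

/-! ### `C¹` maps as differentiable maps into `L1`. -/

theorem IsC1On.exists_lift {f : ℝ → H →L[ℂ] H} {S : Set ℝ} (hf : IsC1On τ f S) :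
    ∃ F D : ℝ → L1 τ, (∀ x ∈ S, L1.val (F x) = f x) ∧
      (∀ x ∈ S, HasDerivWithinAt F (D x) S x) ∧ ContinuousOn D S := by
  classical
  obtain ⟨d, h1, h2, h3⟩ := hf
  -- Outside `S` nothing forces the values into `l¹(N)`; the default `0` there is harmless, as all
  -- limits are taken within `S`.
  let F : ℝ → L1 τ := fun x => if h : f x ∈ l1 τ then L1.mk (f x) h else 0
  let D : ℝ → L1 τ := fun x => if h : d x ∈ l1 τ then L1.mk (d x) h else 0
  have hF : ∀ x ∈ S, L1.val (F x) = f x := fun x hx => by simp [F, (h1 x hx).1]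
  have hD : ∀ x ∈ S, L1.val (D x) = d x := fun x hx => by simp [D, (h1 x hx).2]
  refine ⟨F, D, hF, fun x hx => ?_, fun x hx => ?_⟩
  · rw [hasDerivWithinAt_iff_tendsto_slope, tendsto_iff_edist_tendsto_0]
    refine (h2 x hx).congr' ?_
    filter_upwards [self_mem_nhdsWithin] with y hy
    rw [edist_eq_enorm_sub, ← L1.l1Norm_val, slope_def_module, map_sub, hD x hx,
      L1.val_real_smul, map_sub, hF y hy.1, hF x hx]
  · rw [ContinuousWithinAt, tendsto_iff_edist_tendsto_0]
    refine (h3 x hx).congr' ?_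
    filter_upwards [self_mem_nhdsWithin] with y hy
    rw [edist_eq_enorm_sub, ← L1.l1Norm_val, map_sub, hD x hx, hD y hy]

theorem isC1On_of_lift {f : ℝ → H →L[ℂ] H} {S : Set ℝ} {F D : ℝ → L1 τ}
    (hF : ∀ x ∈ S, L1.val (F x) = f x) (h1 : ∀ x ∈ S, HasDerivWithinAt F (D x) S x)
    (h2 : ContinuousOn D S) : IsC1On τ f S := by
  refine ⟨fun x => L1.val (D x), fun x hx => ⟨hF x hx ▸ (F x).val_mem, (D x).val_mem⟩,
    fun x hx => ?_, fun x hx => ?_⟩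
  · have := h1 x hx
    rw [hasDerivWithinAt_iff_tendsto_slope, tendsto_iff_edist_tendsto_0] at this
    refine this.congr' ?_
    filter_upwards [self_mem_nhdsWithin] with y hy
    rw [edist_eq_enorm_sub, ← L1.l1Norm_val, slope_def_module, map_sub,
      L1.val_real_smul, map_sub, hF y hy.1, hF x hx]
  · have := h2 x hx
    rw [ContinuousWithinAt, tendsto_iff_edist_tendsto_0] at this
    refine this.congr' ?_
    filter_upwards [self_mem_nhdsWithin] with y hy
    rw [edist_eq_enorm_sub, ← L1.l1Norm_val, map_sub]

theorem star_mem_compactIdeal {T : H →L[ℂ] H} (hT : T ∈ compactIdeal τ) :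
    star T ∈ compactIdeal τ := by
  refine map_mem_closure (f := fun T : H →L[ℂ] H => star T) continuous_star hT ?_
  intro x hx
  induction hx using Submodule.span_induction with
  | mem x hx =>
    obtain ⟨B, hB, C, hC, P, hP, h1, h2, rfl⟩ := hx
    exact Submodule.subset_span ⟨star C, star_mem hC, star B, star_mem hB, P, hP, h1, h2, by
      simp only [star_mul, h1.isSelfAdjoint.star_eq, mul_assoc]⟩
  | zero => simp
  | add x y _ _ hx hy => simpa using (finiteIdeal τ).add_mem hx hy
  | smul c x _ hx => simpa using (finiteIdeal τ).smul_mem (star c) hx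

/-! ### The topological group `Gl_K(N)` and its `C¹` loops. -/

namespace GlK

theorem isUnit (g : GlK τ) : IsUnit (g : H →L[ℂ] H) := by
  obtain ⟨h, -, h1, h2⟩ := g.2.2.1
  exact ⟨⟨g, h, h1, h2⟩, rfl⟩

theorem mul_inverse (g : GlK τ) : (g : H →L[ℂ] H) * Ring.inverse (g : H →L[ℂ] H) = 1 :=
  Ring.mul_inverse_cancel _ (isUnit g)

theorem inverse_mul (g : GlK τ) : Ring.inverse (g : H →L[ℂ] H) * (g : H →L[ℂ] H) = 1 :=
  Ring.inverse_mul_cancel _ (isUnit g)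

theorem inverse_mem (g : GlK τ) : Ring.inverse (g : H →L[ℂ] H) ∈ N :=
  mem_of_inverse g.2.1 (mul_inverse g) (inverse_mul g)

theorem mem_of_isUnit {g : H →L[ℂ] H} (hg : g ∈ N) (hu : IsUnit g)
    (hK : g - 1 ∈ compactIdeal τ) : g ∈ GlK τ := by
  have h1 := Ring.mul_inverse_cancel g hu
  have h2 := Ring.inverse_mul_cancel g hu
  exact ⟨hg, ⟨_, mem_of_inverse hg h1 h2, h1, h2⟩, hK⟩

variable (τ) in
/-- Multiplication on `Gl_K(N)`. -/
def mul : C(GlK τ × GlK τ, GlK τ) where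
  toFun p := ⟨p.1 * p.2, mem_of_isUnit (mul_mem p.1.2.1 p.2.2.1) ((isUnit p.1).mul (isUnit p.2)) (by
    have := (compactIdeal τ).add_mem (compactIdeal_mul_left τ p.1.2.1 p.2.2.2.2) p.1.2.2.2
    simpa [mul_sub] using this)⟩

variable (τ) in
/-- Inversion on `Gl_K(N)`. -/
def inv : C(GlK τ, GlK τ) where
  toFun g := ⟨Ring.inverse (g : H →L[ℂ] H), mem_of_isUnit (inverse_mem g) (isUnit g).ringInverse (by
    have := (compactIdeal τ).neg_mem (compactIdeal_mul_left τ (inverse_mem g) g.2.2.2)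
    rwa [mul_sub, inverse_mul g, mul_one, neg_sub] at this)⟩
  continuous_toFun := by
    refine Continuous.subtype_mk (continuous_iff_continuousAt.2 fun g => ?_) _
    obtain ⟨u, hu⟩ := isUnit g
    have := NormedRing.inverse_continuousAt u
    rw [hu] at this
    exact this.comp continuous_subtype_val.continuousAt

variable (τ) in
/-- The adjoint on `Gl_K(N)`. -/
def adj : C(GlK τ, GlK τ) where
  toFun g := ⟨star (g : H →L[ℂ] H), mem_of_isUnit (star_mem g.2.1) (isUnit g).star (by
    have := star_mem_compactIdeal g.2.2.2
    simpa using this)⟩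

variable (τ) in
/-- An element of `Gl_K(N)` as an element of `N`. -/
def toN : C(GlK τ, N) where
  toFun g := ⟨g, g.2.1⟩

@[simp] theorem coe_toN (g : GlK τ) : (toN τ g : H →L[ℂ] H) = g := rfl

end GlK

variable (τ) in
/-- Loops in `Gl_K(N)`. -/
abbrev Loop : Type _ := C(AddCircle (1 : ℝ), GlK τ)

namespace Loop

/-- The product of two loops. -/
def mul (σ ρ : Loop τ) : Loop τ := (GlK.mul τ).comp (σ.prodMk ρ)

/-- The inverse of a loop. -/
def inv (σ : Loop τ) : Loop τ := (GlK.inv τ).comp σ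

/-- The pointwise adjoint of a loop. -/
def adj (σ : Loop τ) : Loop τ := (GlK.adj τ).comp σ

/-- A loop as a function on the line with values in `N`. -/
def toN (σ : Loop τ) (x : ℝ) : N := GlK.toN τ (σ (x : AddCircle (1 : ℝ)))

/-- The inverse of a loop as a function on the line with values in `N`. -/
def invN (σ : Loop τ) : ℝ → N := toN (inv σ)

@[simp] theorem coe_toN (σ : Loop τ) (x : ℝ) : (toN σ x : H →L[ℂ] H) = lift τ σ x := rfl

@[simp] theorem coe_invN (σ : Loop τ) (x : ℝ) :
    (invN σ x : H →L[ℂ] H) = Ring.inverse (lift τ σ x) := rfl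

@[simp] theorem lift_mul (σ ρ : Loop τ) (x : ℝ) :
    lift τ (mul σ ρ) x = lift τ σ x * lift τ ρ x := rfl

@[simp] theorem lift_inv (σ : Loop τ) (x : ℝ) : lift τ (inv σ) x = Ring.inverse (lift τ σ x) := rfl

@[simp] theorem lift_adj (σ : Loop τ) (x : ℝ) : lift τ (adj σ) x = star (lift τ σ x) := rfl

theorem lift_mul_inverse (σ : Loop τ) (x : ℝ) : lift τ σ x * Ring.inverse (lift τ σ x) = 1 :=
  GlK.mul_inverse _

theorem inverse_mul_lift (σ : Loop τ) (x : ℝ) : Ring.inverse (lift τ σ x) * lift τ σ x = 1 :=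
  GlK.inverse_mul _

theorem continuous_toN (σ : Loop τ) : Continuous (toN σ) :=
  (GlK.toN τ).continuous.comp (σ.continuous.comp (AddCircle.continuous_mk' 1))

theorem continuous_invN (σ : Loop τ) : Continuous (invN σ) := continuous_toN _

/-- `F` and `D` are the function `σ - 1` on `[0, 1]` and its derivative, as functions with values
in `l¹(N)`. -/
structure IsC1Data (σ : Loop τ) (F D : ℝ → L1 τ) : Prop where
  val_eq : ∀ x ∈ Set.Icc (0 : ℝ) 1, L1.val (F x) = lift τ σ x - 1
  deriv : ∀ x ∈ Set.Icc (0 : ℝ) 1, HasDerivWithinAt F (D x) (Set.Icc 0 1) x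
  cont : ContinuousOn D (Set.Icc 0 1)

theorem exists_isC1Data {σ : Loop τ} (hσ : IsC1Loop τ σ) : ∃ F D, IsC1Data σ F D := by
  obtain ⟨F, D, h1, h2, h3⟩ := hσ.exists_lift
  exact ⟨F, D, h1, h2, h3⟩

namespace IsC1Data

variable {σ ρ : Loop τ} {F D G E : ℝ → L1 τ}

theorem isC1Loop (h : IsC1Data σ F D) : IsC1Loop τ σ := isC1On_of_lift h.val_eq h.deriv h.cont

theorem hasDerivWithinAt_lift (h : IsC1Data σ F D) {x : ℝ} (hx : x ∈ Set.Icc (0 : ℝ) 1) :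
    HasDerivWithinAt (lift τ σ) (L1.val (D x)) (Set.Icc 0 1) x := by
  have h1 : HasDerivWithinAt (fun y => L1.val (F y)) (L1.val (D x)) (Set.Icc 0 1) x :=
    ((L1.val (τ := τ)).restrictScalars ℝ).hasFDerivAt.comp_hasDerivWithinAt x (h.deriv x hx)
  refine (h1.add_const 1).congr (fun y hy => ?_) ?_
  · rw [h.val_eq y hy, sub_add_cancel]
  · rw [h.val_eq x hx, sub_add_cancel]

theorem integrand_eq (h : IsC1Data σ F D) {x : ℝ} (hx : x ∈ Set.Icc (0 : ℝ) 1) :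
    integrand τ σ x = L1.tr (L1.lmul (invN σ x) (D x)) := by
  rw [integrand, (h.hasDerivWithinAt_lift hx).derivWithin (uniqueDiffOn_Icc zero_lt_one x hx)]
  rfl

theorem continuousOn_tr_lmul (h : IsC1Data σ F D) {X : ℝ → N}
    (hX : ContinuousOn X (Set.Icc 0 1)) :
    ContinuousOn (fun x => L1.tr (L1.lmul (X x) (D x))) (Set.Icc 0 1) :=
  (L1.tr (τ := τ)).continuous.comp_continuousOn
    (L1.continuous_lmul.comp_continuousOn (hX.prodMk h.cont))

theorem continuousOn_integrand (h : IsC1Data σ F D) :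
    ContinuousOn (integrand τ σ) (Set.Icc 0 1) :=
  (h.continuousOn_tr_lmul (continuous_invN σ).continuousOn).congr fun _ hx => h.integrand_eq hx

theorem intervalIntegrable (h : IsC1Data σ F D) :
    IntervalIntegrable (integrand τ σ) MeasureTheory.volume 0 1 :=
  ContinuousOn.intervalIntegrable (by
    rw [Set.uIcc_of_le zero_le_one]; exact h.continuousOn_integrand)

/-- The decomposition is `σρ - 1 = σ(ρ - 1) + (σ - 1)`. In the slope, `σ(y)` multiplies the
increment of `ρ` and `ρ(x)` that of `σ`, so norm continuity of `σ` and joint continuity of the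
module actions suffice. -/
theorem mul (hσ : IsC1Data σ F D) (hρ : IsC1Data ρ G E) :
    IsC1Data (Loop.mul σ ρ) (fun x => L1.lmul (toN σ x) (G x) + F x)
      (fun x => L1.lmul (toN σ x) (E x) + L1.rmul (D x) (toN ρ x)) where
  val_eq x hx := by
    rw [map_add, L1.val_lmul, hσ.val_eq x hx, hρ.val_eq x hx, lift_mul, coe_toN]
    noncomm_ring
  deriv x hx := by
    have h1 := hσ.deriv x hx
    have h2 := hρ.deriv x hx
    rw [hasDerivWithinAt_iff_tendsto_slope] at h1 h2 ⊢
    have c1 : Filter.Tendsto (toN σ) (𝓝[Set.Icc 0 1 \ {x}] x) (𝓝 (toN σ x)) :=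
      ((continuous_toN σ).tendsto x).mono_left nhdsWithin_le_nhds
    have t1 := (L1.continuous_lmul.tendsto (toN σ x, E x)).comp (c1.prodMk_nhds h2)
    have t2 := (L1.continuous_rmul.tendsto (D x, toN ρ x)).comp
      (h1.prodMk_nhds (tendsto_const_nhds (x := toN ρ x)))
    refine (t1.add t2).congr' ?_
    filter_upwards [self_mem_nhdsWithin] with y hy
    refine L1.val_injective ?_
    simp only [Function.comp, slope_def_module, map_add, L1.val_lmul, L1.val_rmul,
      L1.val_real_smul, map_sub, hσ.val_eq x hx, hρ.val_eq x hx, hσ.val_eq y hy.1,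
      hρ.val_eq y hy.1, coe_toN, mul_smul_comm, smul_mul_assoc, ← smul_add]
    congr 1
    noncomm_ring
  cont := ((L1.continuous_lmul.comp_continuousOn
    ((continuous_toN σ).continuousOn.prodMk hρ.cont)).add (L1.continuous_rmul.comp_continuousOn
      (hσ.cont.prodMk (continuous_toN ρ).continuousOn)))

theorem inv (hσ : IsC1Data σ F D) :
    IsC1Data (Loop.inv σ) (fun x => -L1.lmul (invN σ x) (F x))
      (fun x => -L1.rmul (L1.lmul (invN σ x) (D x)) (invN σ x)) where
  val_eq x hx := by
    rw [map_neg, L1.val_lmul, hσ.val_eq x hx, lift_inv, coe_invN, mul_sub, inverse_mul_lift,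
      mul_one, neg_sub]
  deriv x hx := by
    have h1 := hσ.deriv x hx
    rw [hasDerivWithinAt_iff_tendsto_slope] at h1 ⊢
    have c1 : Filter.Tendsto (invN σ) (𝓝[Set.Icc 0 1 \ {x}] x) (𝓝 (invN σ x)) :=
      ((continuous_invN σ).tendsto x).mono_left nhdsWithin_le_nhds
    have t1 := (L1.continuous_lmul.tendsto (invN σ x, D x)).comp (c1.prodMk_nhds h1)
    have t2 := (L1.continuous_rmul.tendsto (_, invN σ x)).comp
      (t1.prodMk_nhds (tendsto_const_nhds (x := invN σ x)))
    refine t2.neg.congr' ?_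
    filter_upwards [self_mem_nhdsWithin] with y hy
    refine L1.val_injective ?_
    simp only [Function.comp, slope_def_module, map_neg, L1.val_lmul, L1.val_rmul,
      L1.val_real_smul, map_sub, hσ.val_eq x hx, hσ.val_eq y hy.1, coe_invN, mul_smul_comm,
      smul_mul_assoc, ← smul_neg]
    congr 1
    have e1 := lift_mul_inverse σ x
    have e2 := inverse_mul_lift σ y
    have e3 := inverse_mul_lift σ x
    -- The identity is `σ(y)⁻¹ - σ(x)⁻¹ = -σ(y)⁻¹ (σ(y) - σ(x)) σ(x)⁻¹`.
    rw [sub_sub_sub_cancel_right, mul_sub, mul_sub, mul_sub, e2, e3, sub_mul, one_mul,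
      mul_assoc, e1]
    simp only [mul_one]
    abel
  cont := (L1.continuous_rmul.comp_continuousOn ((L1.continuous_lmul.comp_continuousOn
    ((continuous_invN σ).continuousOn.prodMk hσ.cont)).prodMk
      (continuous_invN σ).continuousOn)).neg

theorem adj (hσ : IsC1Data σ F D) :
    IsC1Data (Loop.adj σ) (fun x => L1.adj (F x)) (fun x => L1.adj (D x)) where
  val_eq x hx := by rw [L1.val_adj, hσ.val_eq x hx, lift_adj, star_sub, star_one]
  deriv x hx := by
    have h1 := hσ.deriv x hx
    rw [hasDerivWithinAt_iff_tendsto_slope] at h1 ⊢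
    refine ((L1.continuous_adj.tendsto (D x)).comp h1).congr' ?_
    filter_upwards [self_mem_nhdsWithin] with y hy
    refine L1.val_injective ?_
    simp only [Function.comp, slope_def_module, L1.val_adj, L1.val_real_smul, map_sub, star_smul,
      star_sub, star_trivial]
  cont := L1.continuous_adj.comp_continuousOn hσ.cont

end IsC1Data

theorem _root_.WindingNumber.IsC1Loop.mul {σ ρ : Loop τ} (hσ : IsC1Loop τ σ)
    (hρ : IsC1Loop τ ρ) : IsC1Loop τ (mul σ ρ) := by
  obtain ⟨F, D, h⟩ := exists_isC1Data hσ
  obtain ⟨G, E, h'⟩ := exists_isC1Data hρ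
  exact (h.mul h').isC1Loop

theorem _root_.WindingNumber.IsC1Loop.inv {σ : Loop τ} (hσ : IsC1Loop τ σ) :
    IsC1Loop τ (inv σ) := by
  obtain ⟨F, D, h⟩ := exists_isC1Data hσ
  exact h.inv.isC1Loop

theorem _root_.WindingNumber.IsC1Loop.adj {σ : Loop τ} (hσ : IsC1Loop τ σ) :
    IsC1Loop τ (adj σ) := by
  obtain ⟨F, D, h⟩ := exists_isC1Data hσ
  exact h.adj.isC1Loop

/-! ### Additivity of the winding number and its vanishing near `1`. -/

theorem winding_mul {σ ρ : Loop τ} (hσ : IsC1Loop τ σ) (hρ : IsC1Loop τ ρ) :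
    winding τ (mul σ ρ) = winding τ σ + winding τ ρ := by
  obtain ⟨F, D, h⟩ := exists_isC1Data hσ
  obtain ⟨G, E, h'⟩ := exists_isC1Data hρ
  rw [winding, winding, winding, ← mul_add, ← intervalIntegral.integral_add h.intervalIntegrable
    h'.intervalIntegrable]
  congr 1
  refine intervalIntegral.integral_congr fun x hx => ?_
  rw [Set.uIcc_of_le zero_le_one] at hx
  have hinv : Ring.inverse (lift τ σ x * lift τ ρ x) =
      Ring.inverse (lift τ ρ x) * Ring.inverse (lift τ σ x) :=
    Ring.inverse_mul (Or.inl (GlK.isUnit _))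
  have hl : ∀ (X : N) (A : L1 τ), L1.tr (L1.lmul X A) = trace τ (X * L1.val A) := fun _ _ => rfl
  have m1 := L1.val_mem (L1.lmul (invN σ x) (D x))
  have m2 := L1.val_mem (L1.lmul (invN ρ x) (E x))
  -- The product rule gives `ρ⁻¹ (σ⁻¹ σ') ρ + ρ⁻¹ ρ'`; cyclicity removes the conjugation by `ρ`.
  have hc := trace_mul_comm (X := lift τ ρ x)
    (L1.val_mem (L1.lmul (invN ρ x) (L1.lmul (invN σ x) (D x)))) (toN ρ x).2
  rw [(h.mul h').integrand_eq hx, h.integrand_eq hx, h'.integrand_eq hx, hl, hl, hl]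
  simp only [L1.val_lmul, coe_invN] at m1 m2 hc
  simp only [coe_invN, lift_mul, map_add, L1.val_lmul, L1.val_rmul, coe_toN, hinv]
  rw [← mul_assoc, lift_mul_inverse, one_mul] at hc
  rw [hc]
  refine Eq.trans ?_
    (trace_add (mul_right_mem_l1 (mul_left_mem_l1 (invN ρ x).2 m1) (toN ρ x).2) m2)
  congr 1
  have e := inverse_mul_lift σ x
  have e' : Ring.inverse (lift τ σ x) * (lift τ σ x * L1.val (E x)) = L1.val (E x) := by
    rw [← mul_assoc, e, one_mul]
  simp only [mul_add, mul_assoc, e']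
  abel

/-- By cyclicity the integrand of `σ*` is the conjugate of that of `σ`; the sign comes from
conjugating `(2πi)⁻¹`. -/
theorem winding_adj {σ : Loop τ} (hσ : IsC1Loop τ σ) :
    winding τ (adj σ) = -star (winding τ σ) := by
  obtain ⟨F, D, h⟩ := exists_isC1Data hσ
  have e : ∫ x in (0 : ℝ)..1, integrand τ (adj σ) x =
      star (∫ x in (0 : ℝ)..1, integrand τ σ x) := by
    rw [intervalIntegral.integral_of_le zero_le_one, intervalIntegral.integral_of_le zero_le_one,
      Complex.star_def, ← integral_conj, ← intervalIntegral.integral_of_le zero_le_one,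
      ← intervalIntegral.integral_of_le zero_le_one]
    refine intervalIntegral.integral_congr fun x hx => ?_
    rw [Set.uIcc_of_le zero_le_one] at hx
    change integrand τ (adj σ) x = star (integrand τ σ x)
    rw [h.adj.integrand_eq hx, h.integrand_eq hx, L1.tr_lmul_eq_tr_rmul (invN σ x), ← L1.tr_adj]
    congr 1
    refine L1.val_injective ?_
    simp only [L1.val_lmul, L1.val_rmul, L1.val_adj, coe_invN, lift_adj, star_mul,
      Ring.inverse_star]
  rw [winding, winding, e]
  simp only [Complex.star_def, map_mul, map_inv₀, Complex.conj_I, Complex.conj_ofReal, map_ofNat]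
  rw [mul_neg, inv_neg, neg_mul, neg_neg]

/-- Here `T m` is the sum of `Q ^ (m - j) * P ^ j` over `j ≤ m`. In the telescoping sum of `P ^ j (P
- Q) Q ^ (m - j)` the trace lets the powers of `Q` move to the front. The factor `X` is there for
the induction, which replaces it by `Q * X`. -/
theorem trace_mul_pow_sub_pow {P Q X : H →L[ℂ] H} (hP : P ∈ l1 τ) (hQ : Q ∈ l1 τ) (hX : X ∈ N)
    (hXQ : Commute X Q) {T : ℕ → H →L[ℂ] H} (hT0 : T 0 = 1)
    (hT : ∀ m, T (m + 1) = Q * T m + P ^ (m + 1)) (hTN : ∀ m, T m ∈ N) (m : ℕ) :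
    trace τ (X * (P ^ (m + 1) - Q ^ (m + 1))) = trace τ (X * T m * (P - Q)) := by
  have hPQ : P - Q ∈ l1 τ := (l1Submodule τ).sub_mem hP hQ
  have hpow : ∀ {R : H →L[ℂ] H}, R ∈ l1 τ → ∀ m, R ^ (m + 1) ∈ l1 τ := fun {R} hR m => by
    rw [pow_succ]; exact mul_left_mem_l1 (pow_mem hR.1 m) hR
  induction m generalizing X with
  | zero => simp [hT0]
  | succ m ih =>
    have hd : P ^ (m + 1) - Q ^ (m + 1) ∈ l1 τ := (l1Submodule τ).sub_mem (hpow hP m) (hpow hQ m)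
    have h1 := ih (mul_mem hQ.1 hX) ((Commute.refl Q).mul_left hXQ)
    have h2 := trace_mul_comm (mul_left_mem_l1 hX hd) hQ.1
    have e1 : X * (P ^ (m + 1 + 1) - Q ^ (m + 1 + 1)) =
        X * P ^ (m + 1) * (P - Q) + X * (P ^ (m + 1) - Q ^ (m + 1)) * Q := by
      rw [pow_succ P (m + 1), pow_succ Q (m + 1)]; noncomm_ring
    have e2 : X * T (m + 1) * (P - Q) =
        X * P ^ (m + 1) * (P - Q) + Q * X * T m * (P - Q) := by
      rw [hT, ← hXQ.eq]; noncomm_ring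
    rw [e1, e2, trace_add (mul_left_mem_l1 (mul_mem hX (pow_mem hP.1 _)) hPQ)
        (mul_right_mem_l1 (mul_left_mem_l1 hX hd) hQ.1), ← h2, ← mul_assoc, h1,
      trace_add (mul_left_mem_l1 (mul_mem hX (pow_mem hP.1 _)) hPQ)
        (mul_left_mem_l1 (mul_mem (mul_mem hQ.1 hX) (hTN m)) hPQ)]

namespace IsC1Data

variable {σ : Loop τ} {F D : ℝ → L1 τ}

theorem hasDerivWithinAt_tr_pow (h : IsC1Data σ F D) (m : ℕ) {x : ℝ}
    (hx : x ∈ Set.Icc (0 : ℝ) 1) :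
    HasDerivWithinAt (fun y => L1.tr (L1.lmul ((toN σ y - 1) ^ m) (F y)))
      ((m + 1) * L1.tr (L1.lmul ((toN σ x - 1) ^ m) (D x))) (Set.Icc 0 1) x := by
  set a : ℝ → N := fun y => toN σ y - 1 with ha
  have hac : Continuous a := (continuous_toN σ).sub continuous_const
  -- With `x` fixed, the difference of the function at `y` and `x` is exactly the trace of `T m y *
  -- (F y - F x)`, and `T m y` tends to `(m + 1) a(x) ^ m`.
  let T : ℕ → ℝ → N := fun m => Nat.rec (fun _ => 1) (fun m t y => a x * t y + a y ^ (m + 1)) m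
  have hT0 : T 0 = fun _ => 1 := rfl
  have hTs : ∀ m y, T (m + 1) y = a x * T m y + a y ^ (m + 1) := fun m y => rfl
  have hTc : ∀ m, Continuous (T m) := fun m => by
    induction m with
    | zero => exact continuous_const
    | succ m ih => exact (continuous_const.mul ih).add (hac.pow _)
  have hTx : ∀ m, T m x = ((m + 1 : ℕ) : N) * a x ^ m := fun m => by
    induction m with
    | zero => simp [hT0]
    | succ m ih =>
      rw [hTs, ih, pow_succ' (a x) m, Nat.cast_succ (m + 1), add_mul, one_mul, ← mul_assoc,
        ← mul_assoc, Nat.cast_comm]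
  have h1 := h.deriv x hx
  rw [hasDerivWithinAt_iff_tendsto_slope] at h1 ⊢
  have c1 : Filter.Tendsto (T m) (𝓝[Set.Icc 0 1 \ {x}] x) (𝓝 (T m x)) :=
    ((hTc m).tendsto x).mono_left nhdsWithin_le_nhds
  have t1 := (L1.tr (τ := τ)).continuous.tendsto _ |>.comp
    ((L1.continuous_lmul.tendsto (T m x, D x)).comp (c1.prodMk_nhds h1))
  have ev : L1.tr (L1.lmul (T m x) (D x)) = (m + 1) * L1.tr (L1.lmul (a x ^ m) (D x)) := by
    have : L1.lmul (T m x) (D x) = ((m + 1 : ℕ) : ℂ) • L1.lmul (a x ^ m) (D x) :=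
      L1.val_injective (by simp [hTx, mul_assoc, Nat.cast_smul_eq_nsmul, add_mul, add_smul])
    rw [this, map_smul]; simp
  rw [← ev]
  refine t1.congr' ?_
  filter_upwards [self_mem_nhdsWithin] with y hy
  have ea : ∀ z ∈ Set.Icc (0 : ℝ) 1, L1.val (F z) = a z := fun z hz => by
    rw [h.val_eq z hz]; rfl
  have hpow : ∀ z ∈ Set.Icc (0 : ℝ) 1, L1.val (L1.lmul (a z ^ m) (F z)) = L1.val (F z) ^ (m + 1) :=
    fun z hz => by
      rw [L1.val_lmul, ea z hz, pow_succ]; rfl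
  let T' : ℕ → H →L[ℂ] H := fun k => Subtype.val (T k y)
  have hT' : ∀ k, T' (k + 1) = L1.val (F x) * T' k + L1.val (F y) ^ (k + 1) := fun k => by
    rw [ea x hx, ea y hy.1]; exact congrArg Subtype.val (hTs k y)
  have key := trace_mul_pow_sub_pow (τ := τ) (F y).val_mem (F x).val_mem (one_mem N)
    (Commute.one_left _) (T := T') rfl hT' (fun k => (T k y).2) m
  rw [one_mul, one_mul] at key
  simp only [Function.comp, slope_def_module, ← map_sub]
  have e1 : L1.lmul (T m y) ((y - x)⁻¹ • (F y - F x)) =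
      ((y - x)⁻¹ : ℝ) • L1.lmul (T m y) (F y - F x) := L1.val_injective (by
    simp only [L1.val_lmul, L1.val_real_smul, mul_smul_comm])
  rw [e1, (L1.tr (τ := τ)).map_smul_of_tower]
  congr 1
  rw [L1.tr_apply, L1.tr_apply, L1.val_lmul, map_sub, ← key, map_sub, hpow y hy.1, hpow x hx]

theorem integral_tr_pow (h : IsC1Data σ F D) (m : ℕ) :
    ∫ x in (0 : ℝ)..1, L1.tr (L1.lmul ((toN σ x - 1) ^ m) (D x)) = 0 := by
  have hc : ContinuousOn (fun x => (toN σ x - 1) ^ m) (Set.Icc 0 1) :=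
    (((continuous_toN σ).sub continuous_const).pow m).continuousOn
  have hper : ((1 : ℝ) : AddCircle (1 : ℝ)) = 0 := AddCircle.coe_period 1
  -- Only the values at the end points must agree; the one-sided derivatives may differ.
  have hF : F 0 = F 1 := L1.val_injective (by
    rw [h.val_eq 0 (by simp), h.val_eq 1 (by simp), lift, lift, hper]
    simp)
  have h01 : toN σ 0 = toN σ 1 := by simp [toN, hper]
  have := intervalIntegral.integral_eq_sub_of_hasDerivAt_of_le zero_le_one
    (fun x hx => (h.hasDerivWithinAt_tr_pow m hx).continuousWithinAt)
    (fun x hx => (h.hasDerivWithinAt_tr_pow m ⟨hx.1.le, hx.2.le⟩).hasDerivAt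
      (Icc_mem_nhds hx.1 hx.2))
    ((continuousOn_const.mul (h.continuousOn_tr_lmul hc)).intervalIntegrable_of_Icc zero_le_one)
  rw [intervalIntegral.integral_const_mul, hF, h01, sub_self] at this
  exact (mul_eq_zero.1 this).resolve_left (by exact_mod_cast m.succ_ne_zero)

end IsC1Data

theorem winding_eq_zero {σ : Loop τ} (hσ : IsC1Loop τ σ) {q : ℝ} (hq : q < 1)
    (hs : ∀ x, ‖lift τ σ x - 1‖ ≤ q) : winding τ σ = 0 := by
  obtain ⟨F, D, h⟩ := exists_isC1Data hσ
  have hq0 : 0 ≤ q := (norm_nonneg _).trans (hs 0)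
  set b : ℝ → N := fun y => -(toN σ y - 1) with hb
  have hbc : Continuous b := ((continuous_toN σ).sub continuous_const).neg
  let I : ℕ → ℂ := fun m => ∫ x in (0 : ℝ)..1, L1.tr (L1.lmul (invN σ x * b x ^ m) (D x))
  have hI0 : ∫ x in (0 : ℝ)..1, integrand τ σ x = I 0 := by
    refine intervalIntegral.integral_congr fun x hx => ?_
    rw [Set.uIcc_of_le zero_le_one] at hx
    simp only [pow_zero, mul_one, h.integrand_eq hx]
  have hc : ∀ m, ContinuousOn (fun x => invN σ x * b x ^ m) (Set.Icc 0 1) := fun m =>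
    ((continuous_invN σ).mul (hbc.pow m)).continuousOn
  have hz : ∀ m, ∫ x in (0 : ℝ)..1, L1.tr (L1.lmul (b x ^ m) (D x)) = 0 := fun m => by
    have e : ∀ x, L1.tr (L1.lmul (b x ^ m) (D x)) =
        (-1) ^ m * L1.tr (L1.lmul ((toN σ x - 1) ^ m) (D x)) := fun x => by
      have : L1.lmul (b x ^ m) (D x) = ((-1) ^ m : ℂ) • L1.lmul ((toN σ x - 1) ^ m) (D x) := by
        refine L1.val_injective ?_
        rcases Nat.even_or_odd m with hm | hm
        · rw [hb, hm.neg_pow, hm.neg_one_pow, one_smul]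
        · rw [hb, hm.neg_pow, hm.neg_one_pow]; simp
      rw [this, map_smul, smul_eq_mul]
    simp only [e]
    rw [intervalIntegral.integral_const_mul, h.integral_tr_pow m, mul_zero]
  -- Trading `b ^ m` for `b ^ (m + 1)` one step at a time avoids a Neumann series in `L1`, and with
  -- it any completeness.
  have hI : ∀ m, I (m + 1) = I m := fun m => by
    have := hz m
    have e : ∀ x, L1.tr (L1.lmul (invN σ x * b x ^ m) (D x)) =
        L1.tr (L1.lmul (b x ^ m) (D x)) +
          L1.tr (L1.lmul (invN σ x * b x ^ (m + 1)) (D x)) := fun x => by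
      rw [← map_add]
      congr 1
      refine L1.val_injective ?_
      rw [map_add, L1.val_lmul, L1.val_lmul, L1.val_lmul, ← add_mul]
      congr 1
      have e1 : (invN σ x) * (1 - b x) = 1 := by
        ext1; simpa [hb] using inverse_mul_lift σ x
      have e2 : invN σ x * b x ^ m = b x ^ m + invN σ x * b x ^ (m + 1) := by
        rw [mul_sub, mul_one, sub_eq_iff_eq_add] at e1
        nth_rw 1 [e1]
        rw [add_mul, one_mul, mul_assoc, ← pow_succ']
      exact congr(($e2 : H →L[ℂ] H))
    simp only [I, e]
    rw [intervalIntegral.integral_add, this, zero_add]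
    · exact (h.continuousOn_tr_lmul (hbc.pow m).continuousOn).intervalIntegrable_of_Icc zero_le_one
    · exact (h.continuousOn_tr_lmul (hc (m + 1))).intervalIntegrable_of_Icc zero_le_one
  have hIc : ∀ m, I m = I 0 := fun m => by
    induction m with
    | zero => rfl
    | succ m ih => rw [hI, ih]
  obtain ⟨C, hC⟩ := isCompact_Icc.exists_bound_of_continuousOn
    (((continuous_invN σ).norm.continuousOn (s := Set.Icc (0 : ℝ) 1)).mul h.cont.norm)
  have hbound : ∀ m, ‖I 0‖ ≤ ‖L1.tr (τ := τ)‖ * (C * q ^ m) := fun m => by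
    rw [← hIc m]
    have := intervalIntegral.norm_integral_le_of_norm_le_const (a := (0 : ℝ)) (b := 1)
      (C := ‖L1.tr (τ := τ)‖ * (C * q ^ m))
      (f := fun x => L1.tr (L1.lmul (invN σ x * b x ^ m) (D x))) fun x hx => ?_
    · simpa using this
    · rw [Set.uIoc_of_le zero_le_one] at hx
      have hC' : ‖‖invN σ x‖ * ‖D x‖‖ ≤ C := hC x ⟨hx.1.le, hx.2⟩
      rw [Real.norm_of_nonneg (mul_nonneg (norm_nonneg _) (norm_nonneg _))] at hC'
      refine (L1.tr.le_opNorm _).trans (mul_le_mul_of_nonneg_left ?_ (norm_nonneg _))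
      refine (L1.norm_lmul_le _ _).trans ?_
      have hbq : ‖b x‖ ≤ q := by rw [hb, norm_neg]; exact hs x
      have hbm : ‖invN σ x * b x ^ m‖ ≤ ‖invN σ x‖ * q ^ m := by
        have hp : ‖b x ^ m‖ ≤ ‖b x‖ ^ m := by
          -- The power `0` is separate because `‖1‖ = 1` fails when `H` is zero.
          rcases m.eq_zero_or_pos with rfl | hm
          · rw [pow_zero, pow_zero]; exact ContinuousLinearMap.norm_id_le
          · exact norm_pow_le' _ hm
        exact (norm_mul_le _ _).trans (mul_le_mul_of_nonneg_left
          (hp.trans (pow_le_pow_left₀ (norm_nonneg _) hbq m)) (norm_nonneg _))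
      calc _ ≤ ‖invN σ x‖ * q ^ m * ‖D x‖ := mul_le_mul_of_nonneg_right hbm (norm_nonneg _)
        _ = ‖invN σ x‖ * ‖D x‖ * q ^ m := by ring
        _ ≤ C * q ^ m := mul_le_mul_of_nonneg_right hC' (pow_nonneg hq0 m)
  have hlim : Filter.Tendsto (fun m : ℕ => ‖L1.tr (τ := τ)‖ * (C * q ^ m)) Filter.atTop (𝓝 0) := by
    have := ((tendsto_pow_atTop_nhds_zero_of_lt_one hq0 hq).const_mul C).const_mul ‖L1.tr (τ := τ)‖
    simpa using this
  have h0 : I 0 = 0 := norm_le_zero_iff.1 (ge_of_tendsto' hlim hbound)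
  rw [winding, hI0, h0, mul_zero]

end Loop

/-! ### Density of trigonometric polynomials with finite trace coefficients. -/

variable (τ) in
/-- Trigonometric polynomials with coefficients in the ideal generated by the projections of
finite trace. -/
def trigPolynomials : Submodule ℂ C(AddCircle (1 : ℝ), H →L[ℂ] H) :=
  Submodule.span ℂ {f | ∃ n : ℤ, ∃ k ∈ finiteIdeal τ, ∀ x, f x = fourier n x • k}

theorem apply_mem_finiteIdeal {f : C(AddCircle (1 : ℝ), H →L[ℂ] H)} (hf : f ∈ trigPolynomials τ)
    (x : AddCircle (1 : ℝ)) : f x ∈ finiteIdeal τ := by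
  induction hf using Submodule.span_induction with
  | mem f hf =>
    obtain ⟨n, k, hk, e⟩ := hf
    rw [e]; exact (finiteIdeal τ).smul_mem _ hk
  | zero => exact (finiteIdeal τ).zero_mem
  | add f g _ _ hf hg => exact (finiteIdeal τ).add_mem hf hg
  | smul c f _ hf => exact (finiteIdeal τ).smul_mem c hf

theorem exists_hasDerivAt_of_mem_trigPolynomials {f : C(AddCircle (1 : ℝ), H →L[ℂ] H)}
    (hf : f ∈ trigPolynomials τ) : ∃ F D : ℝ → L1 τ,
      (∀ x : ℝ, L1.val (F x) = f x) ∧ (∀ x, HasDerivAt F (D x) x) ∧ Continuous D := by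
  induction hf using Submodule.span_induction with
  | mem f hf =>
    obtain ⟨n, k, hk, e⟩ := hf
    let K : L1 τ := L1.mk k (finiteIdeal_le_l1Submodule hk)
    have hc : Continuous fun y : ℝ => fourier n (y : AddCircle (1 : ℝ)) :=
      (fourier n).continuous.comp (AddCircle.continuous_mk' 1)
    refine ⟨fun x => fourier n (x : AddCircle (1 : ℝ)) • K, _, fun x => ?_,
      fun x => (hasDerivAt_fourier 1 n x).smul_const K, ?_⟩
    · rw [map_smul, e]; rfl
    · exact (continuous_const.mul hc).smul continuous_const
  | zero => exact ⟨0, 0, fun x => by simp, fun x => hasDerivAt_const x 0, continuous_const⟩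
  | add f g _ _ hf hg =>
    obtain ⟨F, D, h1, h2, h3⟩ := hf
    obtain ⟨G, E, h1', h2', h3'⟩ := hg
    exact ⟨F + G, D + E, fun x => by simp [h1, h1'], fun x => (h2 x).add (h2' x), h3.add h3'⟩
  | smul c f _ hf =>
    obtain ⟨F, D, h1, h2, h3⟩ := hf
    exact ⟨c • F, c • D, fun x => by simp [h1], fun x => (h2 x).const_smul c, h3.const_smul c⟩

/-- Multiplication by the fixed `k` is continuous in `φ`, so the scalar density of the exponentials
carries over. -/
theorem smul_mem_closure_trigPolynomials (φ : C(AddCircle (1 : ℝ), ℂ)) {k : H →L[ℂ] H}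
    (hk : k ∈ finiteIdeal τ) {f : C(AddCircle (1 : ℝ), H →L[ℂ] H)} (hf : ∀ x, f x = φ x • k) :
    f ∈ (trigPolynomials τ).topologicalClosure := by
  let Φ : C(AddCircle (1 : ℝ), ℂ) →L[ℂ] C(AddCircle (1 : ℝ), H →L[ℂ] H) :=
    ContinuousLinearMap.compLeftContinuous ℂ _ ((1 : ℂ →L[ℂ] ℂ).smulRight k)
  have hΦ : ∀ φ x, Φ φ x = φ x • k := fun φ x => by simp [Φ]
  have hle : (Submodule.span ℂ (Set.range <| @fourier 1)).topologicalClosure ≤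
      (trigPolynomials τ).topologicalClosure.comap Φ.toLinearMap := by
    refine Submodule.topologicalClosure_minimal _ (Submodule.span_le.2 ?_) ?_
    · rintro _ ⟨n, rfl⟩
      exact Submodule.le_topologicalClosure _ (Submodule.subset_span ⟨n, k, hk, hΦ _⟩)
    · exact (Submodule.isClosed_topologicalClosure _).preimage Φ.continuous
  rw [span_fourier_closure_eq_top] at hle
  have e : f = Φ φ := by ext1 x; rw [hf, hΦ]
  rw [e]
  exact hle (Submodule.mem_top (x := φ))

/-- A partition of unity approximates `f` uniformly by a finite sum of scalar functions times
elements of the dense ideal, which reduces to scalar coefficient functions. -/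
theorem mem_closure_trigPolynomials {f : C(AddCircle (1 : ℝ), H →L[ℂ] H)}
    (hf : ∀ x, f x ∈ compactIdeal τ) : f ∈ (trigPolynomials τ).topologicalClosure := by
  have hcl := Submodule.isClosed_topologicalClosure (trigPolynomials τ)
  rw [← SetLike.mem_coe, ← hcl.closure_eq, Metric.mem_closure_iff]
  intro ε hε
  have hk : ∀ p, ∃ k ∈ finiteIdeal τ, dist (f p) k < ε := fun p =>
    Metric.mem_closure_iff.1 (hf p) ε hε
  choose k hk hkd using hk
  have hU : ∀ p, IsOpen {x | dist (f x) (k p) < ε} := fun p =>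
    isOpen_lt (by fun_prop) continuous_const
  obtain ⟨t, -, ht⟩ := isCompact_univ.elim_nhds_subcover (fun p => {x | dist (f x) (k p) < ε})
    fun p _ => (hU p).mem_nhds (hkd p)
  obtain ⟨ρ, hρ⟩ := PartitionOfUnity.exists_isSubordinate isClosed_univ
    (fun p : t => {x | dist (f x) (k p) < ε}) (fun p => hU p) (fun x hx => by
      obtain ⟨p, hp, hx⟩ := Set.mem_iUnion₂.1 (ht hx)
      exact Set.mem_iUnion.2 ⟨⟨p, hp⟩, hx⟩)
  let g : t → C(AddCircle (1 : ℝ), H →L[ℂ] H) := fun i =>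
    ⟨fun x => ((ρ i x : ℝ) : ℂ) • k i, by fun_prop⟩
  refine ⟨∑ i, g i, Submodule.sum_mem _ fun i _ => ?_, ?_⟩
  · exact smul_mem_closure_trigPolynomials ⟨fun x => ((ρ i x : ℝ) : ℂ), by fun_prop⟩ (hk i)
      fun x => rfl
  · rw [ContinuousMap.dist_lt_iff hε]
    intro x
    have := ρ.finsum_smul_mem_convex (g := fun i _ => k i) (t := Metric.ball (f x) ε)
      (Set.mem_univ x) (fun i hi => ?_) (convex_ball _ _)
    · rw [finsum_eq_sum_of_fintype, Metric.mem_ball'] at this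
      simpa [ContinuousMap.sum_apply, g, Complex.coe_smul] using this
    · rw [Metric.mem_ball']
      exact hρ i (subset_closure hi)

/-! ### Approximation by `C¹` loops and homotopy invariance. -/

namespace Loop

variable (τ) in
/-- The inclusion of `Gl_K(N)` in `B(H)`. -/
def _root_.WindingNumber.GlK.val : C(GlK τ, H →L[ℂ] H) := ⟨Subtype.val, continuous_subtype_val⟩

theorem isInducing_val_comp :
    Topology.IsInducing fun s : Loop τ => (GlK.val τ).comp s :=
  (GlK.val τ).isInducing_postcomp Topology.IsInducing.subtypeVal

theorem _root_.WindingNumber.IsPeriodicC1Loop.isC1Loop {σ : Loop τ} (h : IsPeriodicC1Loop τ σ) :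
    IsC1Loop τ σ := by
  obtain ⟨F, D, h1, h2, h3⟩ := IsC1On.exists_lift h
  exact isC1On_of_lift (fun x _ => h1 x trivial)
    (fun x _ => (h2 x trivial).mono (Set.subset_univ _)) (h3.mono (Set.subset_univ _))

/-- Units are open among the continuous functions on the circle, so a trigonometric polynomial `f`
close enough to `s - 1` leaves `1 + f` invertible. -/
theorem exists_isPeriodicC1Loop_mem {s : Loop τ} {U : Set (Loop τ)} (hU : U ∈ 𝓝 s) :
    ∃ σ ∈ U, IsPeriodicC1Loop τ σ := by
  rw [isInducing_val_comp.nhds_eq_comap, Filter.mem_comap] at hU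
  obtain ⟨U', hU', hsub⟩ := hU
  set js := (GlK.val τ).comp s with hjs
  have hunit : IsUnit js := (ContinuousMap.isUnit_iff_forall_isUnit _).2 fun x => GlK.isUnit (s x)
  have hW : U' ∩ {g | IsUnit g} ∈ 𝓝 js :=
    Filter.inter_mem hU' (Units.isOpen.mem_nhds hunit)
  have hmem : js - 1 ∈ (trigPolynomials τ).topologicalClosure :=
    mem_closure_trigPolynomials fun x => (s x).2.2.2
  have ht : Filter.Tendsto (fun f : C(AddCircle (1 : ℝ), H →L[ℂ] H) => f + 1) (𝓝 (js - 1))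
      (𝓝 js) := Continuous.tendsto' (by fun_prop) _ _ (by simp)
  obtain ⟨f, ⟨hfU, hfu⟩, hf⟩ := mem_closure_iff_nhds.1 hmem _ (ht hW)
  rw [Set.mem_ofPred_eq, ContinuousMap.isUnit_iff_forall_isUnit] at hfu
  have hg : ∀ x, (f + 1) x ∈ GlK τ := fun x => by
    have hfin := apply_mem_finiteIdeal hf x
    refine GlK.mem_of_isUnit (add_mem (finiteIdeal_le_l1Submodule hfin).1 (one_mem N)) (hfu x) ?_
    have : (f + 1) x - 1 = f x := by simp
    rw [this]
    exact Submodule.le_topologicalClosure _ hfin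
  let σ : Loop τ := ⟨fun x => ⟨(f + 1) x, hg x⟩, by fun_prop⟩
  refine ⟨σ, hsub hfU, ?_⟩
  obtain ⟨F, D, h1, h2, h3⟩ := exists_hasDerivAt_of_mem_trigPolynomials hf
  refine isC1On_of_lift (F := F) (D := D) (fun x _ => ?_) (fun x _ => (h2 x).hasDerivWithinAt)
    h3.continuousOn
  rw [h1]
  simp [lift, σ]

theorem homotopic_of_isUnit {s σ : Loop τ}
    (h : ∀ t ∈ Set.Icc (0 : ℝ) 1, ∀ x,
      IsUnit ((1 - t) • (s x : H →L[ℂ] H) + t • (σ x : H →L[ℂ] H))) :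
    ContinuousMap.Homotopic s σ := by
  have hm : ∀ p : unitInterval × AddCircle (1 : ℝ),
      (1 - p.1.1) • (s p.2 : H →L[ℂ] H) + p.1.1 • (σ p.2 : H →L[ℂ] H) ∈ GlK τ := by
    rintro ⟨t, x⟩
    refine GlK.mem_of_isUnit (add_mem (real_smul_mem _ (s x).2.1) (real_smul_mem _ (σ x).2.1))
      (h t t.2 x) ?_
    have e : (1 - t.1) • (s x : H →L[ℂ] H) + t.1 • (σ x : H →L[ℂ] H) - 1 =
        ((1 - t.1 : ℝ) : ℂ) • ((s x : H →L[ℂ] H) - 1) + (t.1 : ℂ) • ((σ x : H →L[ℂ] H) - 1) := by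
      rw [Complex.coe_smul, Complex.coe_smul]
      module
    simp only
    rw [e]
    exact (compactIdeal τ).add_mem ((compactIdeal τ).smul_mem _ (s x).2.2.2)
      ((compactIdeal τ).smul_mem _ (σ x).2.2.2)
  exact ⟨{ toFun := fun p => ⟨_, hm p⟩
           continuous_toFun := by fun_prop
           map_zero_left := fun x => Subtype.ext (by simp)
           map_one_left := fun x => Subtype.ext (by simp) }⟩

variable (τ) in
/-- The map `(g, h) ↦ g⁻¹ h - 1`. -/
def _root_.WindingNumber.GlK.quotSubOne : C(GlK τ × GlK τ, H →L[ℂ] H) :=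
  (GlK.val τ).comp ((GlK.mul τ).comp ((GlK.inv τ).prodMap (ContinuousMap.id _))) - 1

/-- The map `x ↦ s(x)⁻¹ σ(x) - 1` of two loops. -/
def quotSubOne (s σ : Loop τ) : C(AddCircle (1 : ℝ), H →L[ℂ] H) :=
  (GlK.quotSubOne τ).comp (s.prodMk σ)

theorem quotSubOne_apply (s σ : Loop τ) (x : AddCircle (1 : ℝ)) :
    quotSubOne s σ x = Ring.inverse (s x : H →L[ℂ] H) * (σ x : H →L[ℂ] H) - 1 := rfl

theorem continuous_quotSubOne : Continuous fun p : Loop τ × Loop τ => quotSubOne p.1 p.2 := by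
  refine ContinuousMap.continuous_of_continuous_uncurry _ ?_
  refine (GlK.quotSubOne τ).continuous.comp (Continuous.prodMk ?_ ?_)
  · exact (continuous_fst.comp continuous_fst).eval continuous_snd
  · exact (continuous_snd.comp continuous_fst).eval continuous_snd

theorem eventually_norm_quotSubOne_lt (s : Loop τ) :
    ∀ᶠ p in 𝓝 (s, s), ‖quotSubOne p.1 p.2‖ < 1 := by
  have h0 : quotSubOne s s = 0 := by
    ext1 x; rw [quotSubOne_apply, GlK.inverse_mul, sub_self]; rfl
  refine (continuous_quotSubOne.norm.tendsto (s, s)).eventually_lt_const ?_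
  rw [h0, norm_zero]; exact one_pos

theorem homotopic_of_norm_quotSubOne_lt {s σ : Loop τ} (h : ‖quotSubOne s σ‖ < 1) :
    ContinuousMap.Homotopic s σ := by
  refine homotopic_of_isUnit fun t ht x => ?_
  -- The segment is `s (1 + t (s⁻¹ σ - 1))`, whose second factor is within distance less than `1` of
  -- the identity.
  have e : (1 - t) • (s x : H →L[ℂ] H) + t • (σ x : H →L[ℂ] H) =
      (s x : H →L[ℂ] H) * (1 - (-t) • quotSubOne s σ x) := by
    have e1 := GlK.mul_inverse (s x)
    rw [quotSubOne_apply, neg_smul, sub_neg_eq_add, mul_add, mul_one, mul_smul_comm, mul_sub,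
      ← mul_assoc, e1, one_mul, mul_one]
    module
  rw [e]
  refine (GlK.isUnit _).mul (isUnit_one_sub_of_norm_lt_one ?_)
  rw [norm_smul, norm_neg, Real.norm_of_nonneg ht.1]
  exact (mul_le_of_le_one_left (norm_nonneg _) ht.2).trans_lt
    (((quotSubOne s σ).norm_coe_le_norm x).trans_lt h)

theorem winding_eq_of_norm_quotSubOne_lt {s σ : Loop τ} (hs : IsC1Loop τ s) (hσ : IsC1Loop τ σ)
    (h : ‖quotSubOne s σ‖ < 1) : winding τ s = winding τ σ := by
  have hq := hs.inv.mul hσ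
  have h0 := winding_eq_zero hq h fun x => (quotSubOne s σ).norm_coe_le_norm (x : AddCircle (1 : ℝ))
  have e : mul s (mul (inv s) σ) = σ := by
    ext1 x
    refine Subtype.ext ?_
    change (s x : H →L[ℂ] H) * (Ring.inverse (s x : H →L[ℂ] H) * (σ x : H →L[ℂ] H)) = σ x
    rw [← mul_assoc, GlK.mul_inverse, one_mul]
  have := winding_mul hs hq
  rw [e, h0, add_zero] at this
  exact this.symm

theorem exists_extendedWinding (s : Loop τ) :
    ∃ w : ℂ, ∀ᶠ σ in 𝓝 s, IsC1Loop τ σ → winding τ σ = w := by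
  have h := eventually_norm_quotSubOne_lt s
  rw [nhds_prod_eq, Filter.eventually_prod_self_iff'] at h
  obtain ⟨V, hV, h⟩ := h
  obtain ⟨ρ, hρ, hρ1⟩ := exists_isPeriodicC1Loop_mem hV
  refine ⟨winding τ ρ, Filter.mem_of_superset hV fun σ hσ hσ1 => ?_⟩
  exact winding_eq_of_norm_quotSubOne_lt hσ1 hρ1.isC1Loop (h σ hσ ρ hρ)

/-- The winding number of continuous loops: the common winding number of the nearby `C¹` loops. -/
def extendedWinding (s : Loop τ) : ℂ := (exists_extendedWinding s).choose

theorem eventually_winding_eq (s : Loop τ) :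
    ∀ᶠ σ in 𝓝 s, IsC1Loop τ σ → winding τ σ = extendedWinding s :=
  (exists_extendedWinding s).choose_spec

theorem extendedWinding_eq {σ : Loop τ} (h : IsC1Loop τ σ) : extendedWinding σ = winding τ σ :=
  ((eventually_winding_eq σ).self_of_nhds h).symm

/-- For `s'` near `s`, a `C¹` loop sufficiently close to `s'` computes both extended winding
numbers. -/
theorem isLocallyConstant_extendedWinding : IsLocallyConstant (extendedWinding (τ := τ)) := by
  rw [IsLocallyConstant.iff_eventually_eq]
  intro s
  filter_upwards [(eventually_winding_eq s).eventually_nhds] with s' hs'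
  obtain ⟨σ, ⟨h1, h2⟩, hσ⟩ := exists_isPeriodicC1Loop_mem (hs'.and (eventually_winding_eq s'))
  rw [← h1 hσ.isC1Loop, ← h2 hσ.isC1Loop]

theorem extendedWinding_eq_of_homotopic {s σ : Loop τ} (h : ContinuousMap.Homotopic s σ) :
    extendedWinding s = extendedWinding σ := by
  obtain ⟨F⟩ := h
  have hc := (isLocallyConstant_extendedWinding (τ := τ)).comp_continuous F.curry.continuous
  have e := hc.apply_eq_of_preconnectedSpace 0 1
  have e0 : F.curry 0 = s := by ext1 x; exact F.apply_zero x
  have e1 : F.curry 1 = σ := by ext1 x; exact F.apply_one x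
  simpa only [Function.comp, e0, e1] using e

theorem exists_homotopic_isPeriodicC1Loop (s : Loop τ) :
    ∃ σ : Loop τ, IsPeriodicC1Loop τ σ ∧ ContinuousMap.Homotopic s σ := by
  have hc : Filter.Tendsto (fun σ => (s, σ)) (𝓝 s) (𝓝 (s, s)) :=
    Continuous.tendsto' (by fun_prop) _ _ rfl
  obtain ⟨σ, h, hσ⟩ := exists_isPeriodicC1Loop_mem (hc.eventually (eventually_norm_quotSubOne_lt s))
  exact ⟨σ, hσ, homotopic_of_norm_quotSubOne_lt h⟩

theorem extendedWinding_mul (s ρ : Loop τ) :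
    extendedWinding (mul s ρ) = extendedWinding s + extendedWinding ρ := by
  obtain ⟨σ, hσ, h⟩ := exists_homotopic_isPeriodicC1Loop s
  obtain ⟨σ', hσ', h'⟩ := exists_homotopic_isPeriodicC1Loop ρ
  have hm : ContinuousMap.Homotopic (mul s ρ) (mul σ σ') :=
    (ContinuousMap.Homotopic.refl (GlK.mul τ)).comp (h.prodMk h')
  rw [extendedWinding_eq_of_homotopic h, extendedWinding_eq_of_homotopic h',
    extendedWinding_eq_of_homotopic hm, extendedWinding_eq (hσ.isC1Loop.mul hσ'.isC1Loop),
    extendedWinding_eq hσ.isC1Loop, extendedWinding_eq hσ'.isC1Loop,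
    winding_mul hσ.isC1Loop hσ'.isC1Loop]

theorem isUnit_convex_combination {p : H →L[ℂ] H} (hp : 0 ≤ p) (hu : IsUnit p) {t : ℝ}
    (ht : t ∈ Set.Icc (0 : ℝ) 1) : IsUnit ((1 - t) • p + t • (1 : H →L[ℂ] H)) := by
  -- At `t = 0` invertibility is that of `p`; for `t > 0` the combination dominates `t • 1`.
  rcases eq_or_lt_of_le ht.1 with rfl | h0
  · simpa using hu
  · have h1 : IsStrictlyPositive (t • (1 : H →L[ℂ] H)) := by
      refine IsStrictlyPositive.iff_of_unital.2 ⟨smul_nonneg h0.le zero_le_one, ?_⟩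
      exact (isUnit_one).smul (Units.mk0 t h0.ne')
    exact CStarAlgebra.isUnit_of_le _
      (le_add_of_nonneg_left (smul_nonneg (sub_nonneg.2 ht.2) hp)) h1

variable (τ) in
/-- The constant loop `1`. -/
def const : Loop τ :=
  ContinuousMap.const _ ⟨1, GlK.mem_of_isUnit (one_mem N) isUnit_one (by simp)⟩

theorem winding_im_eq_zero {σ : Loop τ} (hσ : IsC1Loop τ σ) : (winding τ σ).im = 0 := by
  have hp := hσ.adj.mul hσ
  have hc : IsC1Loop τ (const τ) := by
    refine isC1On_of_lift (F := 0) (D := 0) (fun x _ => ?_)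
      (fun x _ => hasDerivWithinAt_const x _ 0) continuousOn_const
    simp [lift, const]
  have hh : ContinuousMap.Homotopic (mul (adj σ) σ) (const τ) :=
    homotopic_of_isUnit fun t ht x => isUnit_convex_combination
      (star_mul_self_nonneg (σ x : H →L[ℂ] H)) ((GlK.isUnit (σ x)).star.mul (GlK.isUnit (σ x))) ht
  have hc0 : winding τ (const τ) = 0 := winding_eq_zero hc zero_lt_one fun x => by
    simp [lift, const]
  have := extendedWinding_eq_of_homotopic hh
  rw [extendedWinding_eq hp, extendedWinding_eq hc, hc0, winding_mul hσ.adj hσ,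
    winding_adj hσ] at this
  have := congr(($this).im)
  simp at this
  linarith

end Loop

/-! ### The homomorphism on `π₁(U_K(N))` and the conclusion. -/

variable (τ) in
/-- The winding number homomorphism on `π₁(U_K(N))`. -/
def windingHom : FreePi1 τ →* Multiplicative ℝ :=
  (freeHomotopyCon τ).lift
    -- Taking the real part loses nothing: each value is the winding number of a homotopic `C¹`
    -- loop, which is real.
    (MonoidHom.mk' (fun s => Multiplicative.ofAdd (Loop.extendedWinding ((inclUK τ).comp s)).re)
      fun s ρ => by
        have e : (inclUK τ).comp (s * ρ) =
          Loop.mul ((inclUK τ).comp s) ((inclUK τ).comp ρ) := rfl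
        rw [e, Loop.extendedWinding_mul, Complex.add_re, ofAdd_add])
    fun s ρ h => by
      have := Loop.extendedWinding_eq_of_homotopic
        ((ContinuousMap.Homotopic.refl (inclUK τ)).comp h)
      exact congr(Multiplicative.ofAdd ($this).re)

theorem windingHom_freeClass (s : C(AddCircle (1 : ℝ), UK τ)) :
    Multiplicative.toAdd (windingHom τ (freeClass τ s)) =
      (Loop.extendedWinding ((inclUK τ).comp s)).re := rfl

end WindingNumber
end

theorem proposition3p2 {H : Type*} [NormedAddCommGroup H] [InnerProductSpace ℂ H]
    [CompleteSpace H] (N : VonNeumannAlgebra H) (τ : WindingNumber.FNSTrace N) :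
    -- the winding number of a `C¹` loop is well defined and real
    (∀ σ : C(AddCircle (1 : ℝ), WindingNumber.GlK τ), WindingNumber.IsC1Loop τ σ →
      ContinuousOn (WindingNumber.integrand τ σ) (Set.Icc 0 1) ∧
        (WindingNumber.winding τ σ).im = 0) ∧
    -- every loop in `U_K(N)` is freely homotopic in `Gl_K(N)` to a `C¹` loop
    (∀ s : C(AddCircle (1 : ℝ), WindingNumber.UK τ),
      ∃ σ : C(AddCircle (1 : ℝ), WindingNumber.GlK τ), WindingNumber.IsPeriodicC1Loop τ σ ∧
        ContinuousMap.Homotopic ((WindingNumber.inclUK τ).comp s) σ) ∧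
    -- the winding number of such `C¹` loops descends to a homomorphism `π₁(U_K(N)) → ℝ`
    (∃! W : WindingNumber.FreePi1 τ →* Multiplicative ℝ,
      ∀ (s : C(AddCircle (1 : ℝ), WindingNumber.UK τ))
        (σ : C(AddCircle (1 : ℝ), WindingNumber.GlK τ)),
        WindingNumber.IsC1Loop τ σ →
        ContinuousMap.Homotopic ((WindingNumber.inclUK τ).comp s) σ →
        ((Multiplicative.toAdd (W (WindingNumber.freeClass τ s)) : ℝ) : ℂ) =
          WindingNumber.winding τ σ) := by
  open WindingNumber in
  refine ⟨fun σ hσ => ?_, fun s => Loop.exists_homotopic_isPeriodicC1Loop _, windingHom τ,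
    fun s σ hσ h => ?_, fun W hW => ?_⟩
  · obtain ⟨F, D, hd⟩ := Loop.exists_isC1Data hσ
    exact ⟨hd.continuousOn_integrand, Loop.winding_im_eq_zero hσ⟩
  · rw [windingHom_freeClass, Loop.extendedWinding_eq_of_homotopic h, Loop.extendedWinding_eq hσ]
    exact Complex.ext (by simp) (by simp [Loop.winding_im_eq_zero hσ])
  · refine MonoidHom.ext fun c => ?_
    obtain ⟨s, rfl⟩ : ∃ s, freeClass τ s = c := Con.mk'_surjective c
    -- Uniqueness: each class has a representative homotopic in `Gl_K(N)` to a `C¹` loop, which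
    -- fixes the value of `W`.
    obtain ⟨σ, hσ, h⟩ := Loop.exists_homotopic_isPeriodicC1Loop ((inclUK τ).comp s)
    have h1 := hW s σ hσ.isC1Loop h
    rw [← Loop.extendedWinding_eq hσ.isC1Loop, ← Loop.extendedWinding_eq_of_homotopic h] at h1
    refine Multiplicative.toAdd.injective ?_
    rw [windingHom_freeClass, ← h1, Complex.ofReal_re]
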